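/- **Refutation-completeness of the Quantified Data Calculus (QDC).** *Language and data.* Work in first-order predicate logic without identity, with connectives $\neg,\wedge,\vee,\forall,\exists$, individual variables, and for each $n\ge 0$ denumerably many $n$-ary predicate variables and $n$-ary functional variables. A *datum* is an expression $(E\underline f)(\underline x):\Gamma/\Delta/\cdots$ given by a finite set $\underline f$ of functional variables, a finite set $\underline x$ of individual variables, and a finite set (the *matrix*) of finite sets of formulas (the *components*); expressions differing only by renaming of bound variables (bound by a quantifier or by the prefix) are identified. We write $\Gamma,A$ for $\Gamma\cup\{A\}$ and $\Gamma/\rho$ for $\{\Gamma\}\cup\rho$. An interpretation (a non-empty domain with values for all variables) verifies the datum iff there are functions as values for $\underline f$ such that, for all individuals as values for $\underline x$, all formulas of some component are true. A datum is *unsatisfiable* if no interpretation verifies it; $\bot$ is the datum with empty prefixes and empty matrix. A datum is *elementary* if all formulas in its matrix are atomic or negations of atomic formulas. It is *standard* if (1) every functional variable in the matrix is in the prefix $\underline f$; (2) in the matrix functional variables are applied only to individual variables; (3) the set $\underline x$ can be totally ordered so that the arguments of every functional term in the matrix form an initial segment, without repetitions, of the ordering. *Rules of QDC* (from premiss to conclusion;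 prefixes that stay unchanged are not shown; variables added to or removed from a prefix are not among the others in that prefix; $t$ is an arbitrary term): - Analytic G-rules: $A\wedge B,\Gamma/\rho$ to $A,B,\Gamma/\rho$; $A\vee B,\Gamma/\rho$ to $A,\Gamma/B,\Gamma/\rho$; $\neg\neg A,\Gamma/\rho$ to $A,\Gamma/\rho$; $\neg(A\wedge B),\Gamma/\rho$ to $\neg A,\Gamma/\neg B,\Gamma/\rho$; $\neg(A\vee B),\Gamma/\rho$ to $\neg A,\neg B,\Gamma/\rho$; $(\underline x):\forall yA,\Gamma/\rho$ to $(\underline x,y):A,\Gamma/\rho$, and $(\underline x):\neg\exists yA,\Gamma/\rho$ to $(\underline x,y):\neg A,\Gamma/\rho$, provided $y$ is not free in $\Gamma,\rho$; $(E\underline f)(\underline x):\exists yA(y),\Gamma/\rho$ to $(E\underline f,g)(\underline x):A(g\underline x),\Gamma/\rho$, and $(E\underline f)(\underline x):\neg\forall yA(y),\Gamma/\rho$ to $(E\underline f,g)(\underline x):\neg A(g\underline x),\Gamma/\rho$, provided $g$ does not occur in $A(y),\Gamma,\rho$ (with $\underline x$ listed in any order without repetitions). Synthetic G-rules: their inverses.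 - NC: $\Gamma,A,\neg A/\rho$ to $\rho$. EM: $\Gamma/\rho$ to $\Gamma,A/\Gamma,\neg A/\rho$. - Del: $\Gamma,\Delta/\rho$ to $\Gamma/\rho$. Exp: $\rho$ to $\Gamma/\rho$. - Inst: $(E\underline f)(\underline x,y):\alpha(y)$ to $(E\underline f)(\underline x):\alpha(t)$. Gen: $(E\underline f)(\underline x):\alpha(t)$ to $(E\underline f,g)(\underline x):\alpha(g\underline x)$, with $g$ not in $\alpha(y)$. - EVE: $(E\underline f,g)(\underline x):\alpha$ to $(E\underline f)(\underline x):\alpha$, with $g$ not in $\alpha$. IVU: $(E\underline f)(\underline x):\alpha$ to $(E\underline f)(\underline x,y):\alpha$, with $y$ not free in $\alpha$. A *deduction* of $\beta$ from $\alpha$ is a finite sequence of data from $\alpha$ to $\beta$ in which each datum after the first is inferred from the preceding one by one of these rules. A *refutation* of $\alpha$ is a deduction of $\bot$ from $\alpha$. *Generalized Instantiation* passes from $(E\underline f)(\underline w)(\underline x):\alpha(\underline x)$ to $(E\underline f)(\underline w):\beta$, where, for some sequences of terms $\underline t_0,\dots,\underline t_m$ ($m\ge 0$), the components of $\beta$ are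 all the unions $C_0(\underline t_0)\cup\dots\cup C_m(\underline t_m)$ with $C_0(\underline x),\dots,C_m(\underline x)$ components of $\alpha(\underline x)$. **Proposition.** Every unsatisfiable standard datum $d$ is refutable in QDC. Moreover, there is a refutation of the following form: first a deduction from $d$, by analytic G-rules only, of an elementary datum $e$; then a QDC deduction from $e$ of a datum $b$ which comes from $e$ by one Generalized Instantiation; then a deduction of $\bot$ from $b$ by NC and EVE only. -/

import Mathlib

namespace QDC


/-! ### Language: first-order predicate logic with functional variables, without identity -/

/-- For every `k` there are denumerably many `k`-ary functional variables and denumerably many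
`k`-ary predicate variables, each numbered by `ℕ`. -/
abbrev QLang : FirstOrder.Language.{0, 0} := ⟨fun _ => ℕ, fun _ => ℕ⟩

/-- A functional variable together with its arity. -/
abbrev FunVar : Type := Σ k : ℕ, QLang.Functions k

/-- Terms in the scope of `n` quantifiers. `Sum.inl a` is the individual variable numbered `a`;
`Sum.inr i` is the variable bound by the `i`-th enclosing quantifier (counted from outside).
So formulas that differ only in the names of quantified variables are literally equal. -/
abbrev Tm (n : ℕ) : Type := QLang.Term (ℕ ⊕ Fin n)

/-- Formulas in the scope of `n` quantifiers; the formulas proper are those with `n = 0`. -/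
inductive Fml : ℕ → Type
  | atom {n k : ℕ} (P : QLang.Relations k) (ts : Fin k → Tm n) : Fml n
  | neg {n : ℕ} (A : Fml n) : Fml n
  | and {n : ℕ} (A B : Fml n) : Fml n
  | or {n : ℕ} (A B : Fml n) : Fml n
  | all {n : ℕ} (A : Fml (n + 1)) : Fml n
  | ex {n : ℕ} (A : Fml (n + 1)) : Fml n

noncomputable instance (n : ℕ) : DecidableEq (Fml n) := Classical.decEq _

/-- The functional variables occurring in a term. -/
def tmFun {α : Type} : QLang.Term α → Finset FunVar
  | .var _ => ∅
  | .func (l := k) f ts => insert ⟨k, f⟩ (Finset.univ.biUnion fun i => tmFun (ts i))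

/-- The individual variables occurring free in a formula. -/
def Fml.ind : {n : ℕ} → Fml n → Finset ℕ
  | _, .atom _ ts => Finset.univ.biUnion fun i => (ts i).varFinsetLeft
  | _, .neg A => A.ind
  | _, .and A B => A.ind ∪ B.ind
  | _, .or A B => A.ind ∪ B.ind
  | _, .all A => A.ind
  | _, .ex A => A.ind

/-- The functional variables occurring in a formula. -/
def Fml.fn : {n : ℕ} → Fml n → Finset FunVar
  | _, .atom _ ts => Finset.univ.biUnion fun i => tmFun (ts i)
  | _, .neg A => A.fn
  | _, .and A B => A.fn ∪ B.fn
  | _, .or A B => A.fn ∪ B.fn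
  | _, .all A => A.fn
  | _, .ex A => A.fn

/-- A literal: an atomic formula or the negation of one. -/
def Fml.IsLiteral {n : ℕ} : Fml n → Prop
  | .atom _ _ => True
  | .neg (.atom _ _) => True
  | _ => False

/-- Passing a substitution under a quantifier. -/
def liftSubst {n m : ℕ} (σ : ℕ ⊕ Fin n → Tm m) : ℕ ⊕ Fin (n + 1) → Tm (m + 1)
  | .inl a => (σ (.inl a)).relabel (Sum.map id Fin.castSucc)
  | .inr i => Fin.lastCases (motive := fun _ => Tm (m + 1)) (.var (.inr (Fin.last m)))
      (fun j => (σ (.inr j)).relabel (Sum.map id Fin.castSucc)) i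

/-- Simultaneous capture-avoiding substitution. -/
def Fml.subst : {n m : ℕ} → Fml n → (ℕ ⊕ Fin n → Tm m) → Fml m
  | _, _, .atom P ts, σ => .atom P fun i => (ts i).subst σ
  | _, _, .neg A, σ => .neg (A.subst σ)
  | _, _, .and A B, σ => .and (A.subst σ) (B.subst σ)
  | _, _, .or A B, σ => .or (A.subst σ) (B.subst σ)
  | _, _, .all A, σ => .all (A.subst (liftSubst σ))
  | _, _, .ex A, σ => .ex (A.subst (liftSubst σ))

/-- `A(t)`, where `A` is the body of a quantified formula `∀ y A(y)` or `∃ y A(y)`. -/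
def Fml.inst (A : Fml 1) (t : Tm 0) : Fml 0 :=
  A.subst (Sum.elim (fun a => .var (.inl a)) fun _ => t)

/-- Substitution of the term `σ y` for each individual variable `y ∈ Y`, simultaneously. -/
def Fml.substVars (Y : Finset ℕ) (σ : ℕ → Tm 0) (A : Fml 0) : Fml 0 :=
  A.subst (Sum.elim (fun a => if a ∈ Y then σ a else .var (.inl a)) Fin.elim0)

/-- The term `g(x₁, …, xₖ)` for a list `xs = [x₁, …, xₖ]` of individual variables. -/
def appVars (xs : List ℕ) (g : QLang.Functions xs.length) : Tm 0 :=
  .func g fun i => .var (.inl (xs.get i))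

/-! ### Matrices -/

/-- A component of a datum: a finite set of formulas. -/
abbrev Component : Type := Finset (Fml 0)

/-- The matrix of a datum: a finite set of components. -/
abbrev Mat : Type := Finset Component

/-- The individual variables occurring free in a matrix. -/
def Mat.ind (α : Mat) : Finset ℕ := α.biUnion fun Γ => Γ.biUnion Fml.ind

/-- The functional variables occurring in a matrix. -/
def Mat.fn (α : Mat) : Finset FunVar := α.biUnion fun Γ => Γ.biUnion Fml.fn

/-- Applying a map to every formula of a matrix. -/
noncomputable def Mat.map (h : Fml 0 → Fml 0) (α : Mat) : Mat :=
  α.image fun Γ => Γ.image h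

/-! ### Renaming -/

/-- Renaming of individual and functional variables in a term. -/
def renTm (π : Equiv.Perm ℕ) (ρ : ℕ → Equiv.Perm ℕ) {n : ℕ} : Tm n → Tm n
  | .var (.inl a) => .var (.inl (π a))
  | .var (.inr i) => .var (.inr i)
  | .func (l := k) f ts => .func (l := k) (ρ k f) fun i => renTm π ρ (ts i)

/-- Renaming of free individual variables and of functional variables in a formula. -/
def Fml.ren (π : Equiv.Perm ℕ) (ρ : ℕ → Equiv.Perm ℕ) : {n : ℕ} → Fml n → Fml n
  | _, .atom P ts => .atom P fun i => renTm π ρ (ts i)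
  | _, .neg A => .neg (A.ren π ρ)
  | _, .and A B => .and (A.ren π ρ) (B.ren π ρ)
  | _, .or A B => .or (A.ren π ρ) (B.ren π ρ)
  | _, .all A => .all (A.ren π ρ)
  | _, .ex A => .ex (A.ren π ρ)

/-- Renaming of a functional variable (the arity is kept). -/
def renFun (ρ : ℕ → Equiv.Perm ℕ) (g : FunVar) : FunVar := ⟨g.1, ρ g.1 g.2⟩

/-! ### Data -/

/-- An expression `(E f̲)(x̲): Γ / Δ / …`: existential functional prefix, universal individual
prefix, matrix. -/
structure Proto where
  fpre : Finset FunVar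
  ipre : Finset ℕ
  matrix : Mat

/-- The free individual variables of an expression. -/
def Proto.freeInd (p : Proto) : Finset ℕ := p.matrix.ind \ p.ipre

/-- The free functional variables of an expression. -/
def Proto.freeFun (p : Proto) : Finset FunVar := p.matrix.fn \ p.fpre

/-- Renaming throughout an expression, prefixes included. -/
noncomputable def Proto.ren (π : Equiv.Perm ℕ) (ρ : ℕ → Equiv.Perm ℕ) (p : Proto) : Proto :=
  ⟨p.fpre.image (renFun ρ), p.ipre.image π, p.matrix.map (Fml.ren π ρ)⟩

/-- `q` results from `p` by renaming variables bound by the prefix: a one-to-one renaming that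
leaves the free variables of `p` alone. -/
def Proto.Similar (p q : Proto) : Prop :=
  ∃ (π : Equiv.Perm ℕ) (ρ : ℕ → Equiv.Perm ℕ),
    (∀ a ∈ p.freeInd, π a = a) ∧ (∀ g ∈ p.freeFun, renFun ρ g = g) ∧ q = p.ren π ρ

/-- A datum: an expression up to renaming of bound variables. -/
def Datum : Type := Quot Proto.Similar

/-- The datum expressed by `p`. -/
def Datum.mk (p : Proto) : Datum := Quot.mk _ p

/-- The datum `⊥`: empty prefixes and no component. -/
def Datum.falsum : Datum := Datum.mk ⟨∅, ∅, ∅⟩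

/-! ### Semantics -/

/-- Truth of a formula in the structure `S` on `M`, where `v` interprets the individual variables
and `xs` the variables bound by the enclosing quantifiers. -/
def Fml.Sat {M : Type} (S : QLang.Structure M) (v : ℕ → M) :
    {n : ℕ} → Fml n → (Fin n → M) → Prop
  | _, .atom P ts, xs => S.RelMap P fun i => (ts i).realize (Sum.elim v xs)
  | _, .neg A, xs => ¬ A.Sat S v xs
  | _, .and A B, xs => A.Sat S v xs ∧ B.Sat S v xs
  | _, .or A B, xs => A.Sat S v xs ∨ B.Sat S v xs
  | _, .all A, xs => ∀ m : M, A.Sat S v (Fin.snoc (α := fun _ => M) xs m)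
  | _, .ex A, xs => ∃ m : M, A.Sat S v (Fin.snoc (α := fun _ => M) xs m)

/-- A matrix is read as a disjunction of conjunctions. -/
def Mat.Sat {M : Type} (S : QLang.Structure M) (v : ℕ → M) (α : Mat) : Prop :=
  ∃ Γ ∈ α, ∀ A ∈ Γ, A.Sat S v Fin.elim0

/-- The functional prefix is read as existential quantification over functions, the individual
prefix as universal quantification over individuals. -/
def Proto.Sat {M : Type} (S : QLang.Structure M) (v : ℕ → M) (p : Proto) : Prop :=
  ∃ S' : QLang.Structure M,
    (∀ (k : ℕ) (P : QLang.Relations k), S'.RelMap P = S.RelMap P) ∧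
    (∀ (k : ℕ) (f : QLang.Functions k), (⟨k, f⟩ : FunVar) ∉ p.fpre → S'.funMap f = S.funMap f) ∧
    ∀ v' : ℕ → M, (∀ a, a ∉ p.ipre → v' a = v a) → p.matrix.Sat S' v'

theorem renTm_realize {M : Type} {S T : QLang.Structure M} {v w : ℕ → M}
    {π : Equiv.Perm ℕ} {ρ : ℕ → Equiv.Perm ℕ} {n : ℕ} (t : Tm n) (xs : Fin n → M)
    (hv : ∀ a ∈ t.varFinsetLeft, w (π a) = v a)
    (hf : ∀ g ∈ tmFun t, ∀ ys, @FirstOrder.Language.Structure.funMap QLang M T g.1 (ρ g.1 g.2) ys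
      = @FirstOrder.Language.Structure.funMap QLang M S g.1 g.2 ys) :
    @FirstOrder.Language.Term.realize QLang M T _ (Sum.elim w xs) (renTm π ρ t)
      = @FirstOrder.Language.Term.realize QLang M S _ (Sum.elim v xs) t := by
  induction t with
  | var x =>
    cases x with
    | inl a => exact hv a (by simp [FirstOrder.Language.Term.varFinsetLeft])
    | inr i => rfl
  | @func k f ts ih =>
    have h1 := hf ⟨k, f⟩ (by simp [tmFun])
    simp only [renTm, FirstOrder.Language.Term.realize]
    rw [h1]
    congr 1
    funext i
    refine ih i (fun a ha => hv a ?_) (fun g hg => hf g ?_)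
    · simp only [FirstOrder.Language.Term.varFinsetLeft, Finset.mem_biUnion]
      exact ⟨i, Finset.mem_univ _, ha⟩
    · simp only [tmFun, Finset.mem_insert, Finset.mem_biUnion]
      exact Or.inr ⟨i, Finset.mem_univ _, hg⟩

theorem Fml.ren_sat {M : Type} {S T : QLang.Structure M} {v w : ℕ → M}
    {π : Equiv.Perm ℕ} {ρ : ℕ → Equiv.Perm ℕ} {n : ℕ} (A : Fml n) (xs : Fin n → M)
    (hr : ∀ (k : ℕ) (P : QLang.Relations k), T.RelMap P = S.RelMap P)
    (hv : ∀ a ∈ A.ind, w (π a) = v a)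
    (hf : ∀ g ∈ A.fn, ∀ ys, @FirstOrder.Language.Structure.funMap QLang M T g.1 (ρ g.1 g.2) ys
      = @FirstOrder.Language.Structure.funMap QLang M S g.1 g.2 ys) :
    (A.ren π ρ).Sat T w xs ↔ A.Sat S v xs := by
  induction A with
  | atom P ts =>
    simp only [Fml.ren, Fml.Sat]
    rw [hr]
    have : ∀ i, @FirstOrder.Language.Term.realize QLang M T _ (Sum.elim w xs) (renTm π ρ (ts i))
        = @FirstOrder.Language.Term.realize QLang M S _ (Sum.elim v xs) (ts i) := fun i =>
      renTm_realize (ts i) xs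
        (fun a ha => hv a (by
          simp only [Fml.ind, Finset.mem_biUnion]; exact ⟨i, Finset.mem_univ _, ha⟩))
        (fun g hg => hf g (by
          simp only [Fml.fn, Finset.mem_biUnion]; exact ⟨i, Finset.mem_univ _, hg⟩))
    simp only [this]
  | neg A ih => exact not_congr (ih xs hv hf)
  | and A B ihA ihB =>
    exact and_congr (ihA xs (fun a h => hv a (Finset.mem_union_left _ h))
        fun g h => hf g (Finset.mem_union_left _ h))
      (ihB xs (fun a h => hv a (Finset.mem_union_right _ h))
        fun g h => hf g (Finset.mem_union_right _ h))
  | or A B ihA ihB =>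
    exact or_congr (ihA xs (fun a h => hv a (Finset.mem_union_left _ h))
        fun g h => hf g (Finset.mem_union_left _ h))
      (ihB xs (fun a h => hv a (Finset.mem_union_right _ h))
        fun g h => hf g (Finset.mem_union_right _ h))
  | all A ih => exact forall_congr' fun m => ih _ hv hf
  | ex A ih => exact exists_congr fun m => ih _ hv hf

theorem Mat.ren_sat {M : Type} {S T : QLang.Structure M} {v w : ℕ → M}
    {π : Equiv.Perm ℕ} {ρ : ℕ → Equiv.Perm ℕ} (α : Mat)
    (hr : ∀ (k : ℕ) (P : QLang.Relations k), T.RelMap P = S.RelMap P)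
    (hv : ∀ a ∈ α.ind, w (π a) = v a)
    (hf : ∀ g ∈ α.fn, ∀ ys, @FirstOrder.Language.Structure.funMap QLang M T g.1 (ρ g.1 g.2) ys
      = @FirstOrder.Language.Structure.funMap QLang M S g.1 g.2 ys) :
    (α.map (Fml.ren π ρ)).Sat T w ↔ α.Sat S v := by
  have key : ∀ Γ ∈ α, ∀ A ∈ Γ, ((A.ren π ρ).Sat T w Fin.elim0 ↔ A.Sat S v Fin.elim0) := by
    intro Γ hΓ A hA
    refine A.ren_sat Fin.elim0 hr (fun a ha => hv a ?_) (fun g hg => hf g ?_)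
    · exact Finset.mem_biUnion.2 ⟨Γ, hΓ, Finset.mem_biUnion.2 ⟨A, hA, ha⟩⟩
    · exact Finset.mem_biUnion.2 ⟨Γ, hΓ, Finset.mem_biUnion.2 ⟨A, hA, hg⟩⟩
  constructor
  · rintro ⟨Δ, hΔ, h⟩
    obtain ⟨Γ, hΓ, rfl⟩ := Finset.mem_image.1 hΔ
    exact ⟨Γ, hΓ, fun A hA => (key Γ hΓ A hA).1 (h _ (Finset.mem_image_of_mem _ hA))⟩
  · rintro ⟨Γ, hΓ, h⟩
    refine ⟨_, Finset.mem_image_of_mem _ hΓ, fun B hB => ?_⟩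
    obtain ⟨A, hA, rfl⟩ := Finset.mem_image.1 hB
    exact (key Γ hΓ A hA).2 (h A hA)

/-- Truth of an expression does not depend on the names of the variables bound by the prefix. -/
theorem Proto.sat_congr {M : Type} (S : QLang.Structure M) (v : ℕ → M) {p q : Proto}
    (h : p.Similar q) : p.Sat S v ↔ q.Sat S v := by
  classical
  obtain ⟨π, ρ, hπ, hρ, rfl⟩ := h
  have hmemX : ∀ a, π a ∈ p.ipre.image π ↔ a ∈ p.ipre := fun a => by simp
  have hmemF : ∀ g, renFun ρ g ∈ p.fpre.image (renFun ρ) ↔ g ∈ p.fpre := by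
    intro g
    refine ⟨fun h => ?_, fun h => Finset.mem_image_of_mem _ h⟩
    obtain ⟨⟨k, f⟩, hf, he⟩ := Finset.mem_image.1 h
    obtain ⟨k', f'⟩ := g
    simp only [renFun, Sigma.mk.injEq] at he
    obtain ⟨rfl, he⟩ := he
    have := (ρ k).injective (eq_of_heq he)
    exact this ▸ hf
  constructor
  · rintro ⟨S', hr, hf, hm⟩
    let T : QLang.Structure M :=
      { funMap := fun {k} f => if (⟨k, f⟩ : FunVar) ∈ p.fpre.image (renFun ρ)
          then S'.funMap (n := k) ((ρ k).symm f) else S.funMap (n := k) f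
        RelMap := fun {k} P => S.RelMap P }
    refine ⟨T, fun k P => rfl, fun k f hn => if_neg hn, fun w hw => ?_⟩
    let v' : ℕ → M := fun a => if a ∈ p.ipre then w (π a) else v a
    refine (Mat.ren_sat (S := S') (T := T) (v := v') (w := w) p.matrix (fun k P => (hr k P).symm) ?_ ?_).2
      (hm v' fun a ha => if_neg ha)
    · intro a ha
      by_cases hx : a ∈ p.ipre
      · simp [v', hx]
      · have h1 := hπ a (Finset.mem_sdiff.2 ⟨ha, hx⟩)
        have h2 := hw (π a) (mt (hmemX a).1 hx)
        simp only [v', hx, if_false]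
        rw [h2, h1]
    · rintro ⟨k, f⟩ hg ys
      by_cases hx : (⟨k, f⟩ : FunVar) ∈ p.fpre
      · have h1 := (hmemF ⟨k, f⟩).2 hx
        change (⟨k, ρ k f⟩ : FunVar) ∈ _ at h1
        change (if (⟨k, ρ k f⟩ : FunVar) ∈ p.fpre.image (renFun ρ)
          then S'.funMap (n := k) ((ρ k).symm (ρ k f)) else S.funMap (n := k) (ρ k f)) ys = _
        rw [if_pos h1, Equiv.symm_apply_apply]
      · have h1 := mt (hmemF ⟨k, f⟩).1 hx
        have h2 := hρ ⟨k, f⟩ (Finset.mem_sdiff.2 ⟨hg, hx⟩)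
        have h3 : ρ k f = f := by simpa [renFun] using h2
        change (⟨k, ρ k f⟩ : FunVar) ∉ _ at h1
        change (if (⟨k, ρ k f⟩ : FunVar) ∈ p.fpre.image (renFun ρ)
          then S'.funMap (n := k) ((ρ k).symm (ρ k f)) else S.funMap (n := k) (ρ k f)) ys = _
        rw [if_neg h1, h3, ← hf k f hx]
  · rintro ⟨T, hr, hf, hm⟩
    let S' : QLang.Structure M :=
      { funMap := fun {k} f => if (⟨k, f⟩ : FunVar) ∈ p.fpre
          then T.funMap (n := k) (ρ k f) else S.funMap (n := k) f
        RelMap := fun {k} P => S.RelMap P }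
    refine ⟨S', fun k P => rfl, fun k f hn => if_neg hn, fun v' hv' => ?_⟩
    let w : ℕ → M := fun b => if b ∈ p.ipre.image π then v' (π.symm b) else v b
    refine (Mat.ren_sat (S := S') (T := T) (v := v') (w := w) p.matrix hr ?_ ?_).1 (hm w fun a ha => if_neg ha)
    · intro a ha
      by_cases hx : a ∈ p.ipre
      · have h1 := (hmemX a).2 hx
        simp only [w, h1, if_true, Equiv.symm_apply_apply]
      · have h1 := hπ a (Finset.mem_sdiff.2 ⟨ha, hx⟩)
        have h2 := mt (hmemX a).1 hx
        simp only [w, h2, if_false]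
        rw [h1, hv' a hx]
    · rintro ⟨k, f⟩ hg ys
      by_cases hx : (⟨k, f⟩ : FunVar) ∈ p.fpre
      · change _ = (if (⟨k, f⟩ : FunVar) ∈ p.fpre
          then T.funMap (n := k) (ρ k f) else S.funMap (n := k) f) ys
        rw [if_pos hx]
      · have h1 := mt (hmemF ⟨k, f⟩).1 hx
        have h2 := hρ ⟨k, f⟩ (Finset.mem_sdiff.2 ⟨hg, hx⟩)
        have h3 : ρ k f = f := by simpa [renFun] using h2
        change (⟨k, ρ k f⟩ : FunVar) ∉ _ at h1
        change _ = (if (⟨k, f⟩ : FunVar) ∈ p.fpre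
          then T.funMap (n := k) (ρ k f) else S.funMap (n := k) f) ys
        rw [if_neg hx, h3]
        rw [h3] at h1
        rw [hf k f h1]

/-- The interpretation given by `S` and `v` verifies the datum `d`. -/
def Datum.Verified {M : Type} (S : QLang.Structure M) (v : ℕ → M) (d : Datum) : Prop :=
  Quot.liftOn d (fun p => p.Sat S v) fun _ _ h => propext (Proto.sat_congr S v h)

/-- No interpretation verifies `d`. (Domains are non-empty because `v` exists.) -/
def Datum.Unsatisfiable (d : Datum) : Prop :=
  ∀ (M : Type) (S : QLang.Structure M) (v : ℕ → M), ¬ d.Verified S v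

/-! ### Standard and elementary data -/

/-- Every functional term `f(t₁, …, tₖ)` occurring in the given term, as a subterm, satisfies
`Q`. -/
def tmApps {α : Type} (Q : ∀ k : ℕ, (Fin k → QLang.Term α) → Prop) : QLang.Term α → Prop
  | .var _ => True
  | .func (l := k) _ ts => Q k ts ∧ ∀ i, tmApps Q (ts i)

/-- Every functional term occurring in the formula has an argument list satisfying `Q`. -/
def Fml.Apps (Q : ∀ n k : ℕ, (Fin k → Tm n) → Prop) : {n : ℕ} → Fml n → Prop
  | n, .atom _ ts => ∀ i, tmApps (Q n) (ts i)
  | _, .neg A => A.Apps Q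
  | _, .and A B => A.Apps Q ∧ B.Apps Q
  | _, .or A B => A.Apps Q ∧ B.Apps Q
  | _, .all A => A.Apps Q
  | _, .ex A => A.Apps Q

/-- Standardness of an expression: (1) every functional variable of the matrix is in the prefix;
(2) in the matrix functional variables are applied to individual variables only; (3) the universal
prefix can be ordered, as a list `xs` without repetitions, so that the arguments of every
functional term of the matrix are an initial segment of `xs`. -/
def Proto.Standard (p : Proto) : Prop :=
  p.matrix.fn ⊆ p.fpre ∧
  (∀ Γ ∈ p.matrix, ∀ A ∈ Γ, A.Apps fun _ _ ts => ∀ i, ∃ x, ts i = .var x) ∧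
  ∃ xs : List ℕ, xs.Nodup ∧ xs.toFinset = p.ipre ∧
    ∀ Γ ∈ p.matrix, ∀ A ∈ Γ, A.Apps fun _ _ ts =>
      ∃ ys : List ℕ, ys <+: xs ∧ List.ofFn ts = ys.map fun a => .var (.inl a)

/-- Standardness does not depend on the names of the bound variables, so it can be tested on any
expression of the datum. -/
def Datum.Standard (d : Datum) : Prop := ∃ p : Proto, d = Datum.mk p ∧ p.Standard

/-- All formulas of all components are literals. -/
def Datum.Elementary (d : Datum) : Prop :=
  ∃ p : Proto, d = Datum.mk p ∧ ∀ Γ ∈ p.matrix, ∀ A ∈ Γ, A.IsLiteral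

/-! ### The rules

As usual `Γ, A` stands for `Γ ∪ {A}` and `Γ / ρ` for `{Γ} ∪ ρ`; it is not required that `A ∉ Γ` or
`Γ ∉ ρ`. -/

/-- The analytic (downward) grounding rules. -/
inductive GDown : Proto → Proto → Prop
  | and (F : Finset FunVar) (X : Finset ℕ) (Γ : Component) (ρ : Mat) (A B : Fml 0) :
      GDown ⟨F, X, insert (insert (.and A B) Γ) ρ⟩ ⟨F, X, insert (insert A (insert B Γ)) ρ⟩
  | or (F : Finset FunVar) (X : Finset ℕ) (Γ : Component) (ρ : Mat) (A B : Fml 0) :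
      GDown ⟨F, X, insert (insert (.or A B) Γ) ρ⟩
        ⟨F, X, insert (insert A Γ) (insert (insert B Γ) ρ)⟩
  | negNeg (F : Finset FunVar) (X : Finset ℕ) (Γ : Component) (ρ : Mat) (A : Fml 0) :
      GDown ⟨F, X, insert (insert (.neg (.neg A)) Γ) ρ⟩ ⟨F, X, insert (insert A Γ) ρ⟩
  | negAnd (F : Finset FunVar) (X : Finset ℕ) (Γ : Component) (ρ : Mat) (A B : Fml 0) :
      GDown ⟨F, X, insert (insert (.neg (.and A B)) Γ) ρ⟩
        ⟨F, X, insert (insert (.neg A) Γ) (insert (insert (.neg B) Γ) ρ)⟩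
  | negOr (F : Finset FunVar) (X : Finset ℕ) (Γ : Component) (ρ : Mat) (A B : Fml 0) :
      GDown ⟨F, X, insert (insert (.neg (.or A B)) Γ) ρ⟩
        ⟨F, X, insert (insert (.neg A) (insert (.neg B) Γ)) ρ⟩
  | all (F : Finset FunVar) (X : Finset ℕ) (Γ : Component) (ρ : Mat) (A : Fml 1) (y : ℕ)
      (hX : y ∉ X) (hy : y ∉ Mat.ind (insert (insert (.all A) Γ) ρ)) :
      GDown ⟨F, X, insert (insert (.all A) Γ) ρ⟩
        ⟨F, insert y X, insert (insert (A.inst (.var (.inl y))) Γ) ρ⟩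
  | negEx (F : Finset FunVar) (X : Finset ℕ) (Γ : Component) (ρ : Mat) (A : Fml 1) (y : ℕ)
      (hX : y ∉ X) (hy : y ∉ Mat.ind (insert (insert (.neg (.ex A)) Γ) ρ)) :
      GDown ⟨F, X, insert (insert (.neg (.ex A)) Γ) ρ⟩
        ⟨F, insert y X, insert (insert (.neg (A.inst (.var (.inl y)))) Γ) ρ⟩
  | ex (F : Finset FunVar) (xs : List ℕ) (hxs : xs.Nodup) (Γ : Component) (ρ : Mat) (A : Fml 1)
      (g : QLang.Functions xs.length) (hF : ⟨xs.length, g⟩ ∉ F)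
      (hg : ⟨xs.length, g⟩ ∉ Mat.fn (insert (insert (.ex A) Γ) ρ)) :
      GDown ⟨F, xs.toFinset, insert (insert (.ex A) Γ) ρ⟩
        ⟨insert ⟨xs.length, g⟩ F, xs.toFinset, insert (insert (A.inst (appVars xs g)) Γ) ρ⟩
  | negAll (F : Finset FunVar) (xs : List ℕ) (hxs : xs.Nodup) (Γ : Component) (ρ : Mat)
      (A : Fml 1) (g : QLang.Functions xs.length) (hF : ⟨xs.length, g⟩ ∉ F)
      (hg : ⟨xs.length, g⟩ ∉ Mat.fn (insert (insert (.neg (.all A)) Γ) ρ)) :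
      GDown ⟨F, xs.toFinset, insert (insert (.neg (.all A)) Γ) ρ⟩
        ⟨insert ⟨xs.length, g⟩ F, xs.toFinset,
          insert (insert (.neg (A.inst (appVars xs g))) Γ) ρ⟩

/-- Non-contradiction. -/
inductive NC : Proto → Proto → Prop
  | mk (F : Finset FunVar) (X : Finset ℕ) (Γ : Component) (ρ : Mat) (A : Fml 0) :
      NC ⟨F, X, insert (insert A (insert (.neg A) Γ)) ρ⟩ ⟨F, X, ρ⟩

/-- Excluded middle. -/
inductive EM : Proto → Proto → Prop
  | mk (F : Finset FunVar) (X : Finset ℕ) (Γ : Component) (ρ : Mat) (A : Fml 0) :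
      EM ⟨F, X, insert Γ ρ⟩ ⟨F, X, insert (insert A Γ) (insert (insert (.neg A) Γ) ρ)⟩

/-- Deletion. -/
inductive Del : Proto → Proto → Prop
  | mk (F : Finset FunVar) (X : Finset ℕ) (Γ Δ : Component) (ρ : Mat) :
      Del ⟨F, X, insert (Γ ∪ Δ) ρ⟩ ⟨F, X, insert Γ ρ⟩

/-- Expansion. -/
inductive Exp : Proto → Proto → Prop
  | mk (F : Finset FunVar) (X : Finset ℕ) (Γ : Component) (ρ : Mat) :
      Exp ⟨F, X, ρ⟩ ⟨F, X, insert Γ ρ⟩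

/-- Instantiation. -/
inductive Inst : Proto → Proto → Prop
  | mk (F : Finset FunVar) (X : Finset ℕ) (α : Mat) (y : ℕ) (hy : y ∉ X) (t : Tm 0) :
      Inst ⟨F, insert y X, α⟩ ⟨F, X, α.map (Fml.substVars {y} fun _ => t)⟩

/-- Generalization: from `α(t)` to `α(g x̲)`, where `y` marks the places concerned in `α(y)`. -/
inductive Gen : Proto → Proto → Prop
  | mk (F : Finset FunVar) (xs : List ℕ) (hxs : xs.Nodup) (α : Mat) (y : ℕ)
      (hy : y ∉ xs) (t : Tm 0) (g : QLang.Functions xs.length)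
      (hF : ⟨xs.length, g⟩ ∉ F) (hg : ⟨xs.length, g⟩ ∉ α.fn) :
      Gen ⟨F, xs.toFinset, α.map (Fml.substVars {y} fun _ => t)⟩
        ⟨insert ⟨xs.length, g⟩ F, xs.toFinset,
          α.map (Fml.substVars {y} fun _ => appVars xs g)⟩

/-- Elimination of a vacuous existential (functional) variable. -/
inductive EVE : Proto → Proto → Prop
  | mk (F : Finset FunVar) (X : Finset ℕ) (α : Mat) (g : FunVar) (hF : g ∉ F) (hg : g ∉ α.fn) :
      EVE ⟨insert g F, X, α⟩ ⟨F, X, α⟩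

/-- Introduction of a vacuous universal variable. -/
inductive IVU : Proto → Proto → Prop
  | mk (F : Finset FunVar) (X : Finset ℕ) (α : Mat) (y : ℕ) (hX : y ∉ X) (hy : y ∉ α.ind) :
      IVU ⟨F, X, α⟩ ⟨F, insert y X, α⟩

/-- The rules of the Quantified Data Calculus. The synthetic grounding rules are the inverses of
the analytic ones. -/
def Rule (p q : Proto) : Prop :=
  GDown p q ∨ GDown q p ∨ NC p q ∨ EM p q ∨ Del p q ∨ Exp p q ∨ Inst p q ∨ Gen p q ∨
    EVE p q ∨ IVU p q

/-- Generalized Instantiation: `(E f̲)(w̲)(x̲): α(x̲)` yields the conjunction, by distribution, of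
finitely many (`m + 1`) instances of `α(x̲)`. The components of the conclusion are all the unions
`C₀(t₀) ∪ … ∪ Cₘ(tₘ)` with components `C₀, …, Cₘ` of `α`, where `tᵢ` is the `i`-th sequence of
terms for the variables `x̲`. -/
inductive GenInst : Proto → Proto → Prop
  | mk (F : Finset FunVar) (W X : Finset ℕ) (hWX : Disjoint W X) (α : Mat) (m : ℕ)
      (σ : Fin (m + 1) → ℕ → Tm 0) :
      GenInst ⟨F, W ∪ X, α⟩
        ⟨F, W, (Fintype.piFinset fun _ : Fin (m + 1) => α).image fun C =>
          Finset.univ.biUnion fun i => (C i).image (Fml.substVars X (σ i))⟩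

/-- Immediate inference between data by a rule `R`, through any expressions of them. -/
def StepBy (R : Proto → Proto → Prop) (d e : Datum) : Prop :=
  ∃ p q : Proto, d = Datum.mk p ∧ e = Datum.mk q ∧ R p q

/-- There is a deduction from `d` to `e` by the rule(s) `R`: a finite sequence of data from `d` to
`e` in which each datum after the first is inferred by `R` from the preceding one. -/
def DeducibleBy (R : Proto → Proto → Prop) : Datum → Datum → Prop :=
  Relation.ReflTransGen (StepBy R)

/-- `e` is deducible from `d` in the Quantified Data Calculus. -/
def Deducible (d e : Datum) : Prop := DeducibleBy Rule d e

/-- A refutation is a deduction of `⊥`. -/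
def Datum.Refutable (d : Datum) : Prop := Deducible d Datum.falsum

end QDC

/-!
# Refutation-completeness of the Quantified Data Calculus

The analytic rules strictly lower the weight `Mat.weight` of a matrix and apply as long as some
formula is not a literal (`GDown.exists_weight_lt`). So they lead from any datum to an elementary
one (`exists_elementary`), and since the conclusion of an analytic rule implies its premiss
(`GDown.sat`), the elementary datum `(E f̲)(x̲): α` is unsatisfiable if the given one is.

By Herbrand's theorem (`exists_contradictory_instances`) there are then finitely many instances of
`α` such that every union of components, one from each instance, contains a formula together with
its negation. For otherwise Rado's selection lemma gives a choice of one component for each of the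
infinitely many substitutions, with no contradiction among the instances chosen, and these literals
define a term model that verifies the elementary datum. The instances serve as one Generalized
Instantiation of the whole universal prefix. NC then removes every component of its conclusion and
EVE the functional prefix (`refute_of_contradictory`).

It remains to obtain a Generalized Instantiation by the rules (`deduce_genInst`), although Inst uses
up the universal variable that it instantiates. The matrix `α` is the result of analysing one
formula `A`, a disjunction of conjunctions (`exists_disj_conj`), so that synthetic rules lead from
`α` to `A` and from there to the universal closure `B` of `A` (`deduce_closure`). The context `Γ` of
a rule that analyses a formula may contain the same formula, which then survives. So `B` can be
instantiated repeatedly, once for each sequence of terms and in each component, a copy being kept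
every time (`deduce_instances`). In the end the copies of `B` are deleted. Matrices without
components, or with an empty component, do not come from a formula in this way. In the former case
Inst alone suffices; the latter does not occur in an unsatisfiable datum.
-/

/-! ### Substitution -/

namespace QDC

open FirstOrder.Language (Term)

theorem tm_subst_subst {α β γ : Type} (t : QLang.Term α) (σ : α → QLang.Term β)
    (τ : β → QLang.Term γ) : (t.subst σ).subst τ = t.subst fun a => (σ a).subst τ := by
  induction t with
  | var a => rfl
  | func f ts ih => simp [Term.subst, ih]

theorem tm_relabel_eq_subst {α β : Type} (t : QLang.Term α) (r : α → β) :
    t.relabel r = t.subst fun a => .var (r a) := by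
  induction t with
  | var a => rfl
  | func f ts ih => simp [Term.subst, ih]

theorem liftSubst_inl {n m : ℕ} (σ : ℕ ⊕ Fin n → Tm m) (a : ℕ) :
    liftSubst σ (.inl a) = (σ (.inl a)).relabel (Sum.map id Fin.castSucc) := rfl

theorem liftSubst_castSucc {n m : ℕ} (σ : ℕ ⊕ Fin n → Tm m) (i : Fin n) :
    liftSubst σ (.inr i.castSucc) = (σ (.inr i)).relabel (Sum.map id Fin.castSucc) := by
  simp [liftSubst]

theorem liftSubst_last {n m : ℕ} (σ : ℕ ⊕ Fin n → Tm m) :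
    liftSubst σ (.inr (Fin.last n)) = .var (.inr (Fin.last m)) := by
  simp [liftSubst]

theorem liftSubst_map_castSucc {n m : ℕ} (σ : ℕ ⊕ Fin n → Tm m) (x : ℕ ⊕ Fin n) :
    liftSubst σ (Sum.map id Fin.castSucc x) = (σ x).relabel (Sum.map id Fin.castSucc) := by
  rcases x with a | i
  · rfl
  · exact liftSubst_castSucc σ i

theorem liftSubst_comp {n m k : ℕ} (σ : ℕ ⊕ Fin n → Tm m) (τ : ℕ ⊕ Fin m → Tm k) :
    (fun a => (liftSubst σ a).subst (liftSubst τ)) = liftSubst fun a => (σ a).subst τ := by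
  have key : ∀ t : Tm m, (t.relabel (Sum.map id Fin.castSucc)).subst (liftSubst τ)
      = (t.subst τ).relabel (Sum.map id Fin.castSucc) := fun t => by
    simp only [tm_relabel_eq_subst, tm_subst_subst]
    congr 1
    funext x
    rw [Term.subst, liftSubst_map_castSucc, tm_relabel_eq_subst]
  funext x
  rcases x with a | i
  · exact key _
  · induction i using Fin.lastCases with
    | last => simp only [liftSubst_last, Term.subst]
    | cast i => rw [liftSubst_castSucc, liftSubst_castSucc, key]

theorem Fml.subst_subst {n m k : ℕ} (A : Fml n) (σ : ℕ ⊕ Fin n → Tm m) (τ : ℕ ⊕ Fin m → Tm k) :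
    (A.subst σ).subst τ = A.subst fun a => (σ a).subst τ := by
  induction A generalizing m k with
  | atom P ts => simp only [Fml.subst, tm_subst_subst]
  | neg A ih => simp only [Fml.subst, ih]
  | and A B ihA ihB => simp only [Fml.subst, ihA, ihB]
  | or A B ihA ihB => simp only [Fml.subst, ihA, ihB]
  | all A ih => simp only [Fml.subst, ih, liftSubst_comp]
  | ex A ih => simp only [Fml.subst, ih, liftSubst_comp]

theorem tm_subst_congr {n m : ℕ} (t : Tm n) (σ τ : ℕ ⊕ Fin n → Tm m)
    (hl : ∀ a ∈ t.varFinsetLeft, σ (.inl a) = τ (.inl a)) (hr : ∀ i, σ (.inr i) = τ (.inr i)) :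
    t.subst σ = t.subst τ := by
  induction t with
  | var x =>
    rcases x with a | i
    · exact hl a (by simp)
    · exact hr i
  | func f ts ih =>
    simp only [Term.subst]
    congr 1
    funext i
    exact ih i fun a ha => hl a (by
      simp only [Term.varFinsetLeft, Finset.mem_biUnion]
      exact ⟨i, Finset.mem_univ _, ha⟩)

theorem liftSubst_congr_inr {n m : ℕ} {σ τ : ℕ ⊕ Fin n → Tm m}
    (hr : ∀ i, σ (.inr i) = τ (.inr i)) (i : Fin (n + 1)) :
    liftSubst σ (.inr i) = liftSubst τ (.inr i) := by
  induction i using Fin.lastCases with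
  | last => simp only [liftSubst_last]
  | cast i => rw [liftSubst_castSucc, liftSubst_castSucc, hr]

/-- A substitution acts only through its values at the free variables. -/
theorem Fml.subst_congr {n m : ℕ} (A : Fml n) (σ τ : ℕ ⊕ Fin n → Tm m)
    (hl : ∀ a ∈ A.ind, σ (.inl a) = τ (.inl a)) (hr : ∀ i, σ (.inr i) = τ (.inr i)) :
    A.subst σ = A.subst τ := by
  induction A generalizing m with
  | atom P ts =>
    simp only [Fml.subst]
    congr 1
    funext i
    exact tm_subst_congr _ _ _ (fun a ha => hl a (by
      simp only [Fml.ind, Finset.mem_biUnion]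
      exact ⟨i, Finset.mem_univ _, ha⟩)) hr
  | neg A ih => exact congrArg Fml.neg (ih _ _ hl hr)
  | and A B ihA ihB =>
    exact congrArg₂ Fml.and (ihA _ _ (fun a h => hl a (Finset.mem_union_left _ h)) hr)
      (ihB _ _ (fun a h => hl a (Finset.mem_union_right _ h)) hr)
  | or A B ihA ihB =>
    exact congrArg₂ Fml.or (ihA _ _ (fun a h => hl a (Finset.mem_union_left _ h)) hr)
      (ihB _ _ (fun a h => hl a (Finset.mem_union_right _ h)) hr)
  | all A ih =>
    exact congrArg Fml.all (ih _ _ (fun a h => by rw [liftSubst_inl, liftSubst_inl, hl a h])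
      (liftSubst_congr_inr hr))
  | ex A ih =>
    exact congrArg Fml.ex (ih _ _ (fun a h => by rw [liftSubst_inl, liftSubst_inl, hl a h])
      (liftSubst_congr_inr hr))

theorem liftSubst_var (n : ℕ) : liftSubst (Term.var : ℕ ⊕ Fin n → Tm n) = Term.var := by
  funext x
  rcases x with a | i
  · rfl
  · induction i using Fin.lastCases with
    | last => rw [liftSubst_last]
    | cast i => rw [liftSubst_castSucc]; rfl

theorem tm_subst_var {α : Type} (t : QLang.Term α) : t.subst Term.var = t := by
  induction t with
  | var a => rfl
  | func f ts ih => simp [Term.subst, ih]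

theorem Fml.subst_var {n : ℕ} (A : Fml n) : A.subst Term.var = A := by
  induction A with
  | atom P ts => simp only [Fml.subst, tm_subst_var]
  | neg A ih => simp only [Fml.subst, ih]
  | and A B ihA ihB => simp only [Fml.subst, ihA, ihB]
  | or A B ihA ihB => simp only [Fml.subst, ihA, ihB]
  | all A ih => simp only [Fml.subst, liftSubst_var, ih]
  | ex A ih => simp only [Fml.subst, liftSubst_var, ih]

theorem notMem_varFinsetLeft_subst {n m : ℕ} {x : ℕ} (t : Tm n) (σ : ℕ ⊕ Fin n → Tm m)
    (h : ∀ b, x ∉ (σ b).varFinsetLeft) : x ∉ (t.subst σ).varFinsetLeft := by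
  induction t with
  | var b => exact h b
  | func f ts ih =>
    simp only [Term.subst, Term.varFinsetLeft, Finset.mem_biUnion, not_exists, not_and]
    exact fun i _ => ih i

theorem notMem_varFinsetLeft_liftSubst {n m : ℕ} {x : ℕ} (σ : ℕ ⊕ Fin n → Tm m)
    (h : ∀ b, x ∉ (σ b).varFinsetLeft) (b : ℕ ⊕ Fin (n + 1)) :
    x ∉ (liftSubst σ b).varFinsetLeft := by
  have key : ∀ t : Tm m, x ∉ t.varFinsetLeft →
      x ∉ (t.relabel (Sum.map id Fin.castSucc) : Tm (m + 1)).varFinsetLeft := by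
    intro t
    induction t with
    | var b => rcases b with a | i <;> simp
    | func f ts ih =>
      simp only [Term.relabel, Term.varFinsetLeft, Finset.mem_biUnion, not_exists, not_and]
      exact fun h i hi => ih i (h i hi)
  rcases b with a | i
  · exact key _ (h _)
  · induction i using Fin.lastCases with
    | last => rw [liftSubst_last]; simp
    | cast i => rw [liftSubst_castSucc]; exact key _ (h _)

theorem Fml.notMem_ind_subst {n m : ℕ} {x : ℕ} (A : Fml n) (σ : ℕ ⊕ Fin n → Tm m)
    (h : ∀ b, x ∉ (σ b).varFinsetLeft) : x ∉ (A.subst σ).ind := by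
  induction A generalizing m with
  | atom P ts =>
    simp only [Fml.subst, Fml.ind, Finset.mem_biUnion, not_exists, not_and]
    exact fun i _ => notMem_varFinsetLeft_subst _ _ h
  | neg A ih => exact ih σ h
  | and A B ihA ihB =>
    simp only [Fml.subst, Fml.ind, Finset.mem_union, not_or]
    exact ⟨ihA σ h, ihB σ h⟩
  | or A B ihA ihB =>
    simp only [Fml.subst, Fml.ind, Finset.mem_union, not_or]
    exact ⟨ihA σ h, ihB σ h⟩
  | all A ih => exact ih _ (notMem_varFinsetLeft_liftSubst σ h)
  | ex A ih => exact ih _ (notMem_varFinsetLeft_liftSubst σ h)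

/-- Simultaneous substitution of `σ a` for every individual variable `a`. -/
def Fml.substAll (σ : ℕ → Tm 0) (A : Fml 0) : Fml 0 :=
  A.subst (Sum.elim σ Fin.elim0)

theorem Fml.substVars_eq_substAll (Y : Finset ℕ) (σ : ℕ → Tm 0) :
    Fml.substVars Y σ = Fml.substAll fun a => if a ∈ Y then σ a else .var (.inl a) := rfl

theorem Fml.substAll_var (A : Fml 0) : A.substAll (fun a => .var (.inl a)) = A := by
  have h : (Sum.elim (fun a => .var (.inl a)) Fin.elim0 : ℕ ⊕ Fin 0 → Tm 0) = Term.var := by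
    funext x
    rcases x with a | i
    · rfl
    · exact i.elim0
  rw [Fml.substAll, h, Fml.subst_var]

theorem Fml.substVars_of_notMem {y : ℕ} {A : Fml 0} (h : y ∉ A.ind) (t : Tm 0) :
    A.substVars {y} (fun _ => t) = A := by
  refine Eq.trans ?_ A.substAll_var
  refine Fml.subst_congr _ _ _ (fun a ha => ?_) fun i => i.elim0
  have : a ≠ y := fun e => h (e ▸ ha)
  simp [this]

theorem Fml.substVars_inst {y : ℕ} {A : Fml 1} (h : y ∉ A.ind) (t : Tm 0) :
    (A.inst (.var (.inl y))).substVars {y} (fun _ => t) = A.inst t := by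
  rw [Fml.inst, Fml.substVars, Fml.subst_subst]
  refine Fml.subst_congr _ _ _ (fun a ha => ?_) fun i => ?_
  · have : a ≠ y := fun e => h (e ▸ ha)
    simp [Term.subst, this]
  · simp [Term.subst]

/-- The body `A(y)` of a quantified formula, made from `A` by turning the free variable `x` into
the variable of the new quantifier. -/
def Fml.abs (x : ℕ) (A : Fml 0) : Fml 1 :=
  A.subst (Sum.elim (fun a => if a = x then .var (.inr 0) else .var (.inl a)) Fin.elim0)

theorem Fml.abs_inst_var (x : ℕ) (A : Fml 0) : (A.abs x).inst (.var (.inl x)) = A := by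
  rw [Fml.inst, Fml.abs, Fml.subst_subst]
  refine Eq.trans ?_ A.substAll_var
  refine Fml.subst_congr _ _ _ (fun a _ => ?_) fun i => i.elim0
  by_cases h : a = x <;> simp [h, Term.subst]

theorem Fml.notMem_ind_abs (x : ℕ) (A : Fml 0) : x ∉ (A.abs x).ind := by
  refine Fml.notMem_ind_subst _ _ fun b => ?_
  rcases b with a | i
  · by_cases h : a = x
    · simp [h]
    · simp [h, Ne.symm h]
  · exact i.elim0

/-- Substitution into `∀ x A` followed by instantiation with `t` is one simultaneous substitution
into `A`; in particular no capture takes place, whatever variables occur in `t` and `σ`. -/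
theorem Fml.abs_subst_inst (x : ℕ) (A : Fml 0) (σ : ℕ → Tm 0) (t : Tm 0) :
    ((A.abs x).subst (liftSubst (Sum.elim σ Fin.elim0))).inst t
      = A.substAll (Function.update σ x t) := by
  rw [Fml.inst, Fml.abs, Fml.subst_subst, Fml.subst_subst]
  refine Fml.subst_congr _ _ _ (fun a _ => ?_) fun i => i.elim0
  by_cases h : a = x
  · subst h
    simp only [Sum.elim_inl, if_true, Term.subst, Function.update_self]
    rw [show (0 : Fin 1) = Fin.last 0 from rfl, liftSubst_last]
    rfl
  · simp only [Sum.elim_inl, h, if_false, Term.subst, liftSubst_inl, ne_eq, not_false_eq_true,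
      Function.update_of_ne, tm_relabel_eq_subst, tm_subst_subst]
    refine Eq.trans ?_ (tm_subst_var (σ a))
    refine tm_subst_congr _ _ _ (fun b _ => rfl) fun i => i.elim0

/-- The universal closure `∀ x₁ … ∀ xₙ A` with respect to the listed variables. -/
def Fml.closure : List ℕ → Fml 0 → Fml 0
  | [], A => A
  | x :: xs, A => .all ((Fml.closure xs A).abs x)

end QDC

/-! ### Truth under substitution, and soundness of the analytic rules read upwards -/

namespace QDC

open FirstOrder.Language (Term)

theorem renTm_one {n : ℕ} (t : Tm n) : renTm 1 (fun _ => 1) t = t := by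
  induction t with
  | var x => rcases x with a | i <;> rfl
  | func f ts ih => simp only [renTm, ih]; rfl

theorem Fml.ren_one {n : ℕ} (A : Fml n) : A.ren 1 (fun _ => 1) = A := by
  induction A with
  | atom P ts => simp only [Fml.ren, renTm_one]
  | neg A ih => simp only [Fml.ren, ih]
  | and A B ihA ihB => simp only [Fml.ren, ihA, ihB]
  | or A B ihA ihB => simp only [Fml.ren, ihA, ihB]
  | all A ih => simp only [Fml.ren, ih]
  | ex A ih => simp only [Fml.ren, ih]

/-- Coincidence lemma: truth depends only on the variables that occur. -/
theorem Fml.sat_congr {M : Type} {S T : QLang.Structure M} {v w : ℕ → M} {n : ℕ} (A : Fml n)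
    (xs : Fin n → M) (hr : ∀ (k : ℕ) (P : QLang.Relations k), T.RelMap P = S.RelMap P)
    (hv : ∀ a ∈ A.ind, w a = v a)
    (hf : ∀ g ∈ A.fn, T.funMap (n := g.1) g.2 = S.funMap (n := g.1) g.2) :
    A.Sat T w xs ↔ A.Sat S v xs := by
  have h := A.ren_sat (π := 1) (ρ := fun _ => 1) xs hr hv fun g hg => congrFun (hf g hg)
  rwa [Fml.ren_one] at h

theorem sum_elim_snoc {M : Type} {n : ℕ} (v : ℕ → M) (xs : Fin n → M) (m : M) :
    (Sum.elim v (Fin.snoc (α := fun _ => M) xs m)) ∘ Sum.map id Fin.castSucc = Sum.elim v xs := by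
  funext x
  rcases x with a | i <;> simp

theorem realize_liftSubst {M : Type} (S : QLang.Structure M) {n k : ℕ} (σ : ℕ ⊕ Fin n → Tm k)
    (v : ℕ → M) (xs : Fin k → M) (m : M) (x : ℕ ⊕ Fin (n + 1)) :
    (liftSubst σ x).realize (Sum.elim v (Fin.snoc (α := fun _ => M) xs m))
      = Sum.elim (fun a => (σ (.inl a)).realize (Sum.elim v xs))
          (Fin.snoc (α := fun _ => M) (fun i => (σ (.inr i)).realize (Sum.elim v xs)) m) x := by
  rcases x with a | i
  · rw [liftSubst_inl, Term.realize_relabel, sum_elim_snoc]; rfl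
  · induction i using Fin.lastCases with
    | last => rw [liftSubst_last]; simp
    | cast i => rw [liftSubst_castSucc, Term.realize_relabel, sum_elim_snoc]; simp

theorem Fml.sat_subst {M : Type} (S : QLang.Structure M) {n k : ℕ} (A : Fml n)
    (σ : ℕ ⊕ Fin n → Tm k) (v : ℕ → M) (xs : Fin k → M) :
    (A.subst σ).Sat S v xs ↔ A.Sat S (fun a => (σ (.inl a)).realize (Sum.elim v xs))
      (fun i => (σ (.inr i)).realize (Sum.elim v xs)) := by
  induction A generalizing k with
  | atom P ts =>
    have h : (fun a => (σ a).realize (Sum.elim v xs))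
        = Sum.elim (fun a => (σ (.inl a)).realize (Sum.elim v xs))
          (fun i => (σ (.inr i)).realize (Sum.elim v xs)) := by
      funext x
      rcases x with a | i <;> rfl
    simp only [Fml.subst, Fml.Sat, Term.realize_subst, h]
  | neg A ih => exact not_congr (ih σ xs)
  | and A B ihA ihB => exact and_congr (ihA σ xs) (ihB σ xs)
  | or A B ihA ihB => exact or_congr (ihA σ xs) (ihB σ xs)
  | all A ih =>
    refine forall_congr' fun m => ?_
    rw [ih]
    simp only [realize_liftSubst, Sum.elim_inl, Sum.elim_inr]
  | ex A ih =>
    refine exists_congr fun m => ?_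
    rw [ih]
    simp only [realize_liftSubst, Sum.elim_inl, Sum.elim_inr]

theorem Fml.sat_inst {M : Type} (S : QLang.Structure M) (A : Fml 1) (t : Tm 0) (v : ℕ → M) :
    (A.inst t).Sat S v Fin.elim0 ↔ A.Sat S v
      (Fin.snoc (α := fun _ => M) Fin.elim0 (t.realize (Sum.elim v Fin.elim0))) := by
  rw [Fml.inst, Fml.sat_subst]
  have h : (fun _ : Fin 1 => t.realize (Sum.elim v Fin.elim0))
      = Fin.snoc (α := fun _ => M) Fin.elim0 (t.realize (Sum.elim v Fin.elim0)) := by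
    funext i
    rw [Subsingleton.elim i (Fin.last 0), Fin.snoc_last]
  rw [← h]
  rfl

theorem Mat.sat_insert {M : Type} (S : QLang.Structure M) (v : ℕ → M) (Γ : Component) (ρ : Mat) :
    Mat.Sat S v (insert Γ ρ) ↔ (∀ A ∈ Γ, A.Sat S v Fin.elim0) ∨ Mat.Sat S v ρ := by
  simp [Mat.Sat]

theorem Mat.sat_congr {M : Type} {S T : QLang.Structure M} {v w : ℕ → M} (α : Mat)
    (hr : ∀ (k : ℕ) (P : QLang.Relations k), T.RelMap P = S.RelMap P)
    (hv : ∀ a ∈ α.ind, w a = v a)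
    (hf : ∀ g ∈ α.fn, T.funMap (n := g.1) g.2 = S.funMap (n := g.1) g.2) :
    α.Sat T w ↔ α.Sat S v := by
  have h := Mat.ren_sat (π := 1) (ρ := fun _ => 1) α hr hv fun g hg => congrFun (hf g hg)
  have h1 : Fml.ren 1 (fun _ => 1) = (id : Fml 0 → Fml 0) := funext Fml.ren_one
  simpa [Mat.map, h1] using h

theorem Mat.mem_ind_insert {a : ℕ} {Γ : Component} {ρ : Mat} :
    a ∈ Mat.ind (insert Γ ρ) ↔ (∃ A ∈ Γ, a ∈ A.ind) ∨ a ∈ ρ.ind := by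
  simp [Mat.ind, Finset.biUnion_insert]

/-- Under fixed prefixes, consequence between matrices carries over to data. -/
theorem Proto.Sat.mono {M : Type} {S : QLang.Structure M} {v : ℕ → M} {F : Finset FunVar}
    {X : Finset ℕ} {α β : Mat}
    (h : ∀ (S' : QLang.Structure M) (v' : ℕ → M), β.Sat S' v' → α.Sat S' v') :
    Proto.Sat S v ⟨F, X, β⟩ → Proto.Sat S v ⟨F, X, α⟩ := by
  rintro ⟨S', hr, hf, hm⟩
  exact ⟨S', hr, hf, fun v' hv' => h S' v' (hm v' hv')⟩

/-- Removal of a universal variable `y` from the prefix, its places in one component being bound by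
a quantifier. `B` is the quantified formula and `C` its instance. -/
theorem Proto.Sat.of_insert_ind {M : Type} {S : QLang.Structure M} {v : ℕ → M}
    {F : Finset FunVar} {X : Finset ℕ} {Γ : Component} {ρ : Mat} {B C : Fml 0} {y : ℕ}
    (hy : y ∉ Mat.ind (insert (insert B Γ) ρ))
    (hBC : ∀ (S' : QLang.Structure M) (v' : ℕ → M),
      (∀ m, C.Sat S' (Function.update v' y m) Fin.elim0) → B.Sat S' v' Fin.elim0) :
    Proto.Sat S v ⟨F, insert y X, insert (insert C Γ) ρ⟩ →
      Proto.Sat S v ⟨F, X, insert (insert B Γ) ρ⟩ := by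
  rintro ⟨S', hr, hf, hm⟩
  refine ⟨S', hr, hf, fun v' hv' => ?_⟩
  simp only [Mat.mem_ind_insert, Finset.mem_insert, exists_eq_or_imp, not_or, not_exists,
    not_and] at hy
  obtain ⟨⟨-, hΓ⟩, hρ⟩ := hy
  have hup : ∀ m a, a ≠ y → Function.update v' y m a = v' a := fun m a h =>
    Function.update_of_ne h _ _
  change Mat.Sat S' v' (insert (insert B Γ) ρ)
  rw [Mat.sat_insert]
  by_cases hs : Mat.Sat S' v' ρ
  · exact Or.inr hs
  have key : ∀ m, ∀ A ∈ insert C Γ, A.Sat S' (Function.update v' y m) Fin.elim0 := by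
    intro m
    have h := hm (Function.update v' y m) fun a ha => by
      simp only [Finset.mem_insert, not_or] at ha
      rw [hup m a ha.1, hv' a ha.2]
    refine ((Mat.sat_insert _ _ _ _).1 h).resolve_right fun h' => hs ?_
    exact (Mat.sat_congr ρ (fun _ _ => rfl) (fun a ha => hup m a fun e => hρ (e ▸ ha))
      fun _ _ => rfl).1 h'
  refine Or.inl fun A hA => ?_
  rcases Finset.mem_insert.1 hA with rfl | hA
  · exact hBC S' v' fun m => key m C (Finset.mem_insert_self _ _)
  · exact (Fml.sat_congr A _ (fun _ _ => rfl) (fun a ha => hup (v' 0) a fun e => hΓ A hA (e ▸ ha))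
      fun _ _ => rfl).1 (key (v' 0) A (Finset.mem_insert_of_mem hA))

/-- Removal of an existential functional variable `g` from the prefix, once no formula of the
matrix depends on it. `C` is the formula containing `g` and `B` the one that replaces it. -/
theorem Proto.Sat.of_insert_fn {M : Type} {S : QLang.Structure M} {v : ℕ → M}
    {F : Finset FunVar} {X : Finset ℕ} {Γ : Component} {ρ : Mat} {B C : Fml 0} {g : FunVar}
    (hg : g ∉ Mat.fn (insert (insert B Γ) ρ))
    (hBC : ∀ (S' : QLang.Structure M) (v' : ℕ → M),
      C.Sat S' v' Fin.elim0 → B.Sat S' v' Fin.elim0) :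
    Proto.Sat S v ⟨insert g F, X, insert (insert C Γ) ρ⟩ →
      Proto.Sat S v ⟨F, X, insert (insert B Γ) ρ⟩ := by
  classical
  rintro ⟨S', hr, hf, hm⟩
  let T : QLang.Structure M :=
    { funMap := fun {k} f => if (⟨k, f⟩ : FunVar) = g then S.funMap f else S'.funMap f
      RelMap := fun {k} P => S'.RelMap P }
  refine ⟨T, hr, fun k f h => ?_, fun v' hv' => ?_⟩
  · by_cases hfg : (⟨k, f⟩ : FunVar) = g
    · exact if_pos hfg
    · refine (if_neg hfg).trans (hf k f fun h' => ?_)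
      exact (Finset.mem_insert.1 h').elim hfg h
  · have hne : ∀ f ∈ Mat.fn (insert (insert B Γ) ρ), f ≠ g := fun f hf' e => hg (e ▸ hf')
    have hT : ∀ f : FunVar, f ≠ g → T.funMap (n := f.1) f.2 = S'.funMap (n := f.1) f.2 :=
      fun ⟨k, f⟩ h => if_neg h
    refine (Mat.sat_congr (S := S') (T := T) (v := v') (insert (insert B Γ) ρ) (fun _ _ => rfl)
      (fun _ _ => rfl) fun f hf' => hT f (hne f hf')).2 ?_
    have h := hm v' hv'
    simp only [Mat.sat_insert, Finset.forall_mem_insert] at h ⊢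
    exact h.imp_left fun h => ⟨hBC S' v' h.1, h.2⟩

theorem Fml.sat_inst_var {M : Type} (S : QLang.Structure M) (A : Fml 1) {y : ℕ} (hy : y ∉ A.ind)
    (v : ℕ → M) (m : M) :
    (A.inst (.var (.inl y))).Sat S (Function.update v y m) Fin.elim0 ↔
      A.Sat S v (Fin.snoc (α := fun _ => M) Fin.elim0 m) := by
  rw [Fml.sat_inst]
  simp only [Term.realize, Sum.elim_inl, Function.update_self]
  have hne : ∀ a ∈ A.ind, a ≠ y := fun a ha e => hy (e ▸ ha)
  exact Fml.sat_congr A _ (fun _ _ => rfl)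
    (fun a ha => Function.update_of_ne (hne a ha) _ _) fun _ _ => rfl

/-- The conclusion of an analytic rule implies its premiss. -/
theorem GDown.sat {M : Type} {S : QLang.Structure M} {v : ℕ → M} {p q : Proto} (h : GDown p q) :
    q.Sat S v → p.Sat S v := by
  cases h with
  | and F X Γ ρ A B =>
    refine Proto.Sat.mono fun S' v' => ?_
    simp only [Mat.sat_insert, Finset.forall_mem_insert, Fml.Sat]
    tauto
  | or F X Γ ρ A B =>
    refine Proto.Sat.mono fun S' v' => ?_
    simp only [Mat.sat_insert, Finset.forall_mem_insert, Fml.Sat]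
    tauto
  | negNeg F X Γ ρ A =>
    refine Proto.Sat.mono fun S' v' => ?_
    simp only [Mat.sat_insert, Finset.forall_mem_insert, Fml.Sat]
    tauto
  | negAnd F X Γ ρ A B =>
    refine Proto.Sat.mono fun S' v' => ?_
    simp only [Mat.sat_insert, Finset.forall_mem_insert, Fml.Sat]
    tauto
  | negOr F X Γ ρ A B =>
    refine Proto.Sat.mono fun S' v' => ?_
    simp only [Mat.sat_insert, Finset.forall_mem_insert, Fml.Sat]
    tauto
  | all F X Γ ρ A y hX hy =>
    refine Proto.Sat.of_insert_ind hy fun S' v' h m => ?_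
    exact (Fml.sat_inst_var S' A (fun h => hy (Mat.mem_ind_insert.2
      (Or.inl ⟨_, Finset.mem_insert_self _ _, h⟩))) v' m).1 (h m)
  | negEx F X Γ ρ A y hX hy =>
    refine Proto.Sat.of_insert_ind hy ?_
    rintro S' v' h ⟨m, hm⟩
    exact h m ((Fml.sat_inst_var S' A (fun h => hy (Mat.mem_ind_insert.2
      (Or.inl ⟨_, Finset.mem_insert_self _ _, h⟩))) v' m).2 hm)
  | ex F xs hxs Γ ρ A g hF hg =>
    exact Proto.Sat.of_insert_fn hg fun S' v' h => ⟨_, (Fml.sat_inst S' A _ v').1 h⟩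
  | negAll F xs hxs Γ ρ A g hF hg =>
    exact Proto.Sat.of_insert_fn hg fun S' v' h h' => h ((Fml.sat_inst S' A _ v').2 (h' _))

end QDC

/-! ### Analytic reduction to elementary data -/

namespace QDC

/-- A rank that every analytic rule lowers when passing from the formula analysed to the formulas
put in its place. -/
def Fml.rank : {n : ℕ} → Fml n → ℕ
  | _, .atom _ _ => 0
  | _, .neg A => A.rank + 1
  | _, .and A B => A.rank + B.rank + 2
  | _, .or A B => A.rank + B.rank + 2
  | _, .all A => A.rank + 1
  | _, .ex A => A.rank + 1

theorem Fml.rank_subst {n m : ℕ} (A : Fml n) (σ : ℕ ⊕ Fin n → Tm m) :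
    (A.subst σ).rank = A.rank := by
  induction A generalizing m with
  | atom P ts => rfl
  | neg A ih => simp only [Fml.subst, Fml.rank, ih]
  | and A B ihA ihB => simp only [Fml.subst, Fml.rank, ihA, ihB]
  | or A B ihA ihB => simp only [Fml.subst, Fml.rank, ihA, ihB]
  | all A ih => simp only [Fml.subst, Fml.rank, ih]
  | ex A ih => simp only [Fml.subst, Fml.rank, ih]

theorem Fml.rank_inst (A : Fml 1) (t : Tm 0) : (A.inst t).rank = A.rank := A.rank_subst _

/-- The sum of the ranks of the formulas of a component. -/
def compRank (Γ : Component) : ℕ := ∑ A ∈ Γ, A.rank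

/-- The weight of a matrix. A component of rank `r` counts `3 ^ r`, so that it outweighs two
components of smaller rank. -/
def Mat.weight (α : Mat) : ℕ := ∑ Γ ∈ α, 3 ^ compRank Γ

theorem sum_insert_le {β : Type} [DecidableEq β] (f : β → ℕ) (a : β) (s : Finset β) :
    ∑ x ∈ insert a s, f x ≤ f a + ∑ x ∈ s, f x := by
  by_cases h : a ∈ s
  · rw [Finset.insert_eq_of_mem h]; exact Nat.le_add_left _ _
  · rw [Finset.sum_insert h]

theorem compRank_insert_le (A : Fml 0) (Γ : Component) :
    compRank (insert A Γ) ≤ A.rank + compRank Γ := sum_insert_le _ _ _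

theorem compRank_insert {A : Fml 0} {Γ : Component} (h : A ∉ Γ) :
    compRank (insert A Γ) = A.rank + compRank Γ := Finset.sum_insert h

theorem Mat.weight_insert_lt {Γ Δ : Component} {ρ : Mat} (hΓ : Γ ∉ ρ)
    (h : compRank Δ < compRank Γ) : Mat.weight (insert Δ ρ) < Mat.weight (insert Γ ρ) := by
  have h1 : Mat.weight (insert Δ ρ) ≤ 3 ^ compRank Δ + Mat.weight ρ := sum_insert_le _ _ _
  have h2 : Mat.weight (insert Γ ρ) = 3 ^ compRank Γ + Mat.weight ρ := Finset.sum_insert hΓ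
  have h3 : 3 ^ compRank Δ < 3 ^ compRank Γ := Nat.pow_lt_pow_right (by norm_num) h
  omega

theorem Mat.weight_insert_insert_lt {Γ Δ₁ Δ₂ : Component} {ρ : Mat} (hΓ : Γ ∉ ρ)
    (h₁ : compRank Δ₁ < compRank Γ) (h₂ : compRank Δ₂ < compRank Γ) :
    Mat.weight (insert Δ₁ (insert Δ₂ ρ)) < Mat.weight (insert Γ ρ) := by
  have h1 : Mat.weight (insert Δ₁ (insert Δ₂ ρ)) ≤ 3 ^ compRank Δ₁ + Mat.weight (insert Δ₂ ρ) :=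
    sum_insert_le _ _ _
  have h2 : Mat.weight (insert Δ₂ ρ) ≤ 3 ^ compRank Δ₂ + Mat.weight ρ := sum_insert_le _ _ _
  have h3 : Mat.weight (insert Γ ρ) = 3 ^ compRank Γ + Mat.weight ρ := Finset.sum_insert hΓ
  obtain ⟨r, hr⟩ : ∃ r, compRank Γ = r + 1 := ⟨compRank Γ - 1, by omega⟩
  have h4 : 3 ^ compRank Δ₁ ≤ 3 ^ r := Nat.pow_le_pow_right (by norm_num) (by omega)
  have h5 : 3 ^ compRank Δ₂ ≤ 3 ^ r := Nat.pow_le_pow_right (by norm_num) (by omega)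
  have h6 : 0 < 3 ^ r := by positivity
  rw [hr, pow_succ] at h3
  omega

theorem exists_fresh_fn (k : ℕ) (s : Finset FunVar) :
    ∃ g : QLang.Functions k, (⟨k, g⟩ : FunVar) ∉ s := by
  obtain ⟨g, hg⟩ := Infinite.exists_notMem_finset
    (s.preimage (fun g : ℕ => (⟨k, g⟩ : FunVar)) (fun _ _ _ _ h => by simpa using h))
  exact ⟨g, fun h => hg (Finset.mem_preimage.2 h)⟩

/-- As long as some formula is not a literal, an analytic rule applies to it. -/
theorem GDown.exists_weight_lt (F : Finset FunVar) (X : Finset ℕ) (α : Mat) (Γ : Component)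
    (hΓ : Γ ∈ α) (D : Fml 0) (hD : D ∈ Γ) (hlit : ¬ D.IsLiteral) :
    ∃ q : Proto, GDown ⟨F, X, α⟩ q ∧ q.matrix.weight < α.weight := by
  obtain ⟨ρ, hρ, rfl⟩ : ∃ ρ, Γ ∉ ρ ∧ α = insert Γ ρ :=
    ⟨α.erase Γ, Finset.notMem_erase _ _, (Finset.insert_erase hΓ).symm⟩
  obtain ⟨Δ, hΔ, rfl⟩ : ∃ Δ, D ∉ Δ ∧ Γ = insert D Δ :=
    ⟨Γ.erase D, Finset.notMem_erase _ _, (Finset.insert_erase hD).symm⟩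
  have one : ∀ A : Fml 0, A.rank < D.rank → compRank (insert A Δ) < compRank (insert D Δ) :=
    fun A h => by
      have := compRank_insert_le A Δ
      rw [compRank_insert hΔ]; omega
  have two : ∀ A B : Fml 0, A.rank + B.rank < D.rank →
      compRank (insert A (insert B Δ)) < compRank (insert D Δ) := fun A B h => by
    have h1 := compRank_insert_le A (insert B Δ)
    have h2 := compRank_insert_le B Δ
    rw [compRank_insert hΔ]; omega
  obtain ⟨y, hy⟩ := Infinite.exists_notMem_finset (X ∪ Mat.ind (insert (insert D Δ) ρ))
  obtain ⟨hyX, hyα⟩ := not_or.1 (mt Finset.mem_union.2 hy)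
  obtain ⟨g, hg⟩ := exists_fresh_fn X.toList.length (F ∪ Mat.fn (insert (insert D Δ) ρ))
  obtain ⟨hgF, hgα⟩ := not_or.1 (mt Finset.mem_union.2 hg)
  have hX : X.toList.toFinset = X := Finset.toList_toFinset X
  cases D with
  | atom P ts => exact absurd trivial hlit
  | and A B =>
    exact ⟨_, .and F X Δ ρ A B, Mat.weight_insert_lt hρ (two A B (by simp [Fml.rank]))⟩
  | or A B =>
    exact ⟨_, .or F X Δ ρ A B, Mat.weight_insert_insert_lt hρ
      (one A (by simp only [Fml.rank]; omega)) (one B (by simp only [Fml.rank]; omega))⟩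
  | all A =>
    exact ⟨_, .all F X Δ ρ A y hyX hyα, Mat.weight_insert_lt hρ
      (one _ (by simp [Fml.rank, Fml.rank_inst]))⟩
  | ex A =>
    have h := GDown.ex F X.toList X.nodup_toList Δ ρ A g hgF hgα
    rw [hX] at h
    exact ⟨_, h, Mat.weight_insert_lt hρ (one _ (by simp [Fml.rank, Fml.rank_inst]))⟩
  | neg D =>
    cases D with
    | atom P ts => exact absurd trivial hlit
    | neg A =>
      exact ⟨_, .negNeg F X Δ ρ A, Mat.weight_insert_lt hρ
        (one A (by simp only [Fml.rank]; omega))⟩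
    | and A B =>
      exact ⟨_, .negAnd F X Δ ρ A B, Mat.weight_insert_insert_lt hρ
        (one _ (by simp only [Fml.rank]; omega)) (one _ (by simp only [Fml.rank]; omega))⟩
    | or A B =>
      exact ⟨_, .negOr F X Δ ρ A B, Mat.weight_insert_lt hρ
        (two _ _ (by simp only [Fml.rank]; omega))⟩
    | ex A =>
      exact ⟨_, .negEx F X Δ ρ A y hyX hyα, Mat.weight_insert_lt hρ
        (one _ (by simp [Fml.rank, Fml.rank_inst]))⟩
    | all A =>
      have h := GDown.negAll F X.toList X.nodup_toList Δ ρ A g hgF hgα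
      rw [hX] at h
      exact ⟨_, h, Mat.weight_insert_lt hρ (one _ (by simp [Fml.rank, Fml.rank_inst]))⟩

theorem exists_elementary (p : Proto) : ∃ q : Proto, Relation.ReflTransGen GDown p q ∧
    ∀ Γ ∈ q.matrix, ∀ A ∈ Γ, A.IsLiteral := by
  induction hn : p.matrix.weight using Nat.strong_induction_on generalizing p with
  | _ n ih =>
    by_cases h : ∀ Γ ∈ p.matrix, ∀ A ∈ Γ, A.IsLiteral
    · exact ⟨p, .refl, h⟩
    · push Not at h
      obtain ⟨Γ, hΓ, A, hA, hlit⟩ := h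
      obtain ⟨q, hpq, hlt⟩ := GDown.exists_weight_lt p.fpre p.ipre p.matrix Γ hΓ A hA hlit
      obtain ⟨r, hqr, hr⟩ := ih _ (hn ▸ hlt) q rfl
      exact ⟨r, .head hpq hqr, hr⟩

end QDC

/-! ### Generalized Instantiation is derivable -/

namespace QDC

open Relation (ReflTransGen)

theorem GDown.rule {p q : Proto} (h : GDown p q) : Rule p q := Or.inl h

theorem GDown.rule_symm {p q : Proto} (h : GDown p q) : Rule q p := Or.inr (Or.inl h)

theorem Del.rule {p q : Proto} (h : Del p q) : Rule p q := by simp [Rule, h]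

theorem Inst.rule {p q : Proto} (h : Inst p q) : Rule p q := by simp [Rule, h]

theorem exists_conj (Γ : Component) (hΓ : Γ.Nonempty) :
    ∃ A : Fml 0, ∀ (σ : ℕ → Tm 0) (F : Finset FunVar) (X : Finset ℕ) (Δ : Component) (ρ : Mat),
      ReflTransGen GDown ⟨F, X, insert (insert (A.substAll σ) Δ) ρ⟩
        ⟨F, X, insert (Γ.image (Fml.substAll σ) ∪ Δ) ρ⟩ := by
  induction hΓ using Finset.Nonempty.cons_induction with
  | singleton A =>
    refine ⟨A, fun σ F X Δ ρ => ?_⟩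
    rw [Finset.image_singleton, ← Finset.insert_eq]
  | cons A Γ hA hΓ ih =>
    obtain ⟨B, hB⟩ := ih
    refine ⟨.and A B, fun σ F X Δ ρ => .head (.and F X Δ ρ (A.substAll σ) (B.substAll σ)) ?_⟩
    have h := hB σ F X (insert (A.substAll σ) Δ) ρ
    rwa [Finset.insert_comm, Finset.union_insert, ← Finset.insert_union, ← Finset.image_insert,
      ← Finset.cons_eq_insert _ _ hA] at h

/-- A matrix without empty components is the result of analysing a single formula: a disjunction
of conjunctions. The formula is the same for all substitution instances and all contexts. -/
theorem exists_disj_conj (α : Mat) (hα : α.Nonempty) (hne : ∀ Γ ∈ α, Γ.Nonempty) :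
    ∃ A : Fml 0, ∀ (σ : ℕ → Tm 0) (F : Finset FunVar) (X : Finset ℕ) (Δ : Component) (ρ : Mat),
      ReflTransGen GDown ⟨F, X, insert (insert (A.substAll σ) Δ) ρ⟩
        ⟨F, X, α.image (fun Γ => Γ.image (Fml.substAll σ) ∪ Δ) ∪ ρ⟩ := by
  induction hα using Finset.Nonempty.cons_induction with
  | singleton Γ =>
    obtain ⟨A, hA⟩ := exists_conj Γ (hne Γ (Finset.mem_singleton_self Γ))
    refine ⟨A, fun σ F X Δ ρ => ?_⟩
    rw [Finset.image_singleton, ← Finset.insert_eq]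
    exact hA σ F X Δ ρ
  | cons Γ α hΓ hα ih =>
    rw [Finset.forall_mem_cons] at hne
    obtain ⟨A, hA⟩ := exists_conj Γ hne.1
    obtain ⟨B, hB⟩ := ih hne.2
    refine ⟨.or A B, fun σ F X Δ ρ => .head (.or F X Δ ρ (A.substAll σ) (B.substAll σ)) ?_⟩
    refine (hA σ F X Δ (insert (insert (B.substAll σ) Δ) ρ)).trans ?_
    have h := hB σ F X Δ (insert (Γ.image (Fml.substAll σ) ∪ Δ) ρ)
    rw [Finset.cons_eq_insert, Finset.image_insert]
    rwa [Finset.insert_comm, Finset.union_insert, ← Finset.insert_union] at h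

theorem Mat.map_substVars_insert_insert {y : ℕ} {Γ : Component} {ρ : Mat} (A : Fml 0) (t : Tm 0)
    (hΓ : ∀ B ∈ Γ, y ∉ B.ind) (hρ : y ∉ ρ.ind) :
    Mat.map (Fml.substVars {y} fun _ => t) (insert (insert A Γ) ρ)
      = insert (insert (A.substVars {y} fun _ => t) Γ) ρ := by
  have h1 : ∀ Δ : Component, (∀ B ∈ Δ, y ∉ B.ind) → Δ.image (Fml.substVars {y} fun _ => t) = Δ :=
    fun Δ h => (Finset.image_congr fun B hB => Fml.substVars_of_notMem (h B hB) t).trans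
      Finset.image_id
  have h2 : ρ.image (fun Δ : Component => Δ.image (Fml.substVars {y} fun _ => t)) = ρ := by
    refine (Finset.image_congr fun Δ hΔ => h1 Δ fun B hB hy => hρ ?_).trans Finset.image_id
    exact Finset.mem_biUnion.2 ⟨Δ, hΔ, Finset.mem_biUnion.2 ⟨B, hB, hy⟩⟩
  rw [Mat.map, Finset.image_insert, Finset.image_insert, h1 Γ hΓ, h2]

/-- A universal formula of a component can be replaced by any of its instances: the quantifier is
analysed with a fresh variable, which is then instantiated. -/
theorem deduce_inst (F : Finset FunVar) (W : Finset ℕ) (Γ : Component) (ρ : Mat) (A : Fml 1)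
    (t : Tm 0) :
    ReflTransGen Rule ⟨F, W, insert (insert (.all A) Γ) ρ⟩
      ⟨F, W, insert (insert (A.inst t) Γ) ρ⟩ := by
  obtain ⟨y, hy⟩ := Infinite.exists_notMem_finset (W ∪ Mat.ind (insert (insert (.all A) Γ) ρ))
  obtain ⟨hyW, hyα⟩ := not_or.1 (mt Finset.mem_union.2 hy)
  have hy' := hyα
  simp only [Mat.mem_ind_insert, Finset.mem_insert, exists_eq_or_imp, not_or, not_exists,
    not_and] at hy'
  obtain ⟨⟨hA, hΓ⟩, hρ⟩ := hy'
  refine .head (GDown.all F W Γ ρ A y hyW hyα).rule (.single ?_)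
  have h := Inst.mk F W (insert (insert (A.inst (.var (.inl y))) Γ) ρ) y hyW t
  rw [Mat.map_substVars_insert_insert _ t hΓ hρ, Fml.substVars_inst hA] at h
  exact h.rule

theorem deduce_closure_inst (F : Finset FunVar) (W : Finset ℕ) (Γ : Component) (ρ : Mat)
    (A : Fml 0) (τ : ℕ → Tm 0) (xs : List ℕ) (σ : ℕ → Tm 0) :
    ReflTransGen Rule ⟨F, W, insert (insert ((Fml.closure xs A).substAll σ) Γ) ρ⟩
      ⟨F, W, insert (insert (A.substAll fun a => if a ∈ xs then τ a else σ a) Γ) ρ⟩ := by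
  induction xs generalizing σ with
  | nil =>
    simp only [Fml.closure, List.not_mem_nil, if_false]
    exact .refl
  | cons x xs ih =>
    refine (deduce_inst F W Γ ρ _ (τ x)).trans ?_
    rw [Fml.abs_subst_inst]
    have h := ih (Function.update σ x (τ x))
    have e : (fun a => if a ∈ xs then τ a else Function.update σ x (τ x) a)
        = fun a => if a ∈ x :: xs then τ a else σ a := by
      funext a
      by_cases ha : a = x
      · subst ha; simp
      · simp [ha]
    rwa [e] at h

/-- Quantifiers absorb the universal prefix, by synthetic rules. -/
theorem deduce_closure (F : Finset FunVar) (A : Fml 0) (xs : List ℕ) (hxs : xs.Nodup)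
    (W : Finset ℕ) (hW : Disjoint W xs.toFinset) :
    ReflTransGen Rule ⟨F, W ∪ xs.toFinset, {{A}}⟩ ⟨F, W, {{Fml.closure xs A}}⟩ := by
  induction xs generalizing W with
  | nil =>
    simp only [List.toFinset_nil, Finset.union_empty, Fml.closure]
    exact .refl
  | cons x xs ih =>
    rw [List.nodup_cons] at hxs
    rw [List.toFinset_cons, Finset.disjoint_insert_right] at hW
    have h := ih hxs.2 (insert x W)
      (Finset.disjoint_insert_left.2 ⟨by simpa using hxs.1, hW.2⟩)
    rw [List.toFinset_cons, Finset.union_insert, ← Finset.insert_union]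
    refine h.tail (GDown.rule_symm ?_)
    have hx : x ∉ Mat.ind (insert (insert (.all ((Fml.closure xs A).abs x)) ∅) ∅) := by
      simpa [Mat.ind, Fml.ind] using Fml.notMem_ind_abs x (Fml.closure xs A)
    have h' := GDown.all F W ∅ ∅ ((Fml.closure xs A).abs x) x hW.1 hx
    rwa [Fml.abs_inst_var] at h'

/-- The matrix of all unions `C₀(t₀) ∪ … ∪ Cₙ₋₁(tₙ₋₁)`, with `Cᵢ` a component of `α` and with `tᵢ`
the terms given by `σ i` for the variables in `X`. -/
noncomputable def Mat.instances (α : Mat) (X : Finset ℕ) (n : ℕ) (σ : Fin n → ℕ → Tm 0) : Mat :=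
  (Fintype.piFinset fun _ : Fin n => α).image fun C =>
    Finset.univ.biUnion fun i => (C i).image (Fml.substVars X (σ i))

theorem Mat.instances_zero (α : Mat) (X : Finset ℕ) (σ : Fin 0 → ℕ → Tm 0) :
    α.instances X 0 σ = {∅} := by
  ext Γ
  simp [Mat.instances]

theorem Mat.instances_succ (α : Mat) (X : Finset ℕ) (n : ℕ) (σ : Fin (n + 1) → ℕ → Tm 0) :
    α.instances X (n + 1) σ = (α.instances X n fun i => σ i.castSucc).biUnion fun Γ =>
      α.image fun C => C.image (Fml.substVars X (σ (Fin.last n))) ∪ Γ := by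
  have hU : ∀ C : Fin (n + 1) → Component,
      (Finset.univ.biUnion fun i => (C i).image (Fml.substVars X (σ i)))
        = (C (Fin.last n)).image (Fml.substVars X (σ (Fin.last n))) ∪
          Finset.univ.biUnion fun i : Fin n =>
            (C i.castSucc).image (Fml.substVars X (σ i.castSucc)) := by
    intro C
    ext A
    simp only [Finset.mem_biUnion, Finset.mem_univ, true_and, Finset.mem_union,
      Fin.exists_fin_succ']
    tauto
  ext Γ
  simp only [Mat.instances, Finset.mem_image, Finset.mem_biUnion, Fintype.mem_piFinset, hU]
  constructor
  · rintro ⟨C, hC, rfl⟩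
    exact ⟨_, ⟨fun i => C i.castSucc, fun i => hC _, rfl⟩, C (Fin.last n), hC _, rfl⟩
  · rintro ⟨_, ⟨C, hC, rfl⟩, D, hD, rfl⟩
    refine ⟨Fin.snoc (α := fun _ => Component) C D, fun i => ?_, ?_⟩
    · induction i using Fin.lastCases with
      | last => simpa using hD
      | cast i => simpa using hC i
    · simp only [Fin.snoc_last, Fin.snoc_castSucc]

/-- If a formula `B` can be expanded, in every component containing it, to the components of an
instance of `α`, then it can be so expanded in any set of components while copies of `B` are kept. -/
theorem deduce_biUnion {F : Finset FunVar} {W : Finset ℕ} {B : Fml 0} {α : Mat}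
    {h : Fml 0 → Fml 0}
    (hB : ∀ (Γ : Component) (ρ : Mat), ReflTransGen Rule ⟨F, W, insert (insert B Γ) ρ⟩
      ⟨F, W, α.image (fun C => C.image h ∪ Γ) ∪ ρ⟩) (U P : Mat) :
    ReflTransGen Rule ⟨F, W, U.image (insert B) ∪ P⟩
      ⟨F, W, (U.biUnion fun Γ => α.image fun C => C.image h ∪ Γ).image (insert B) ∪ P⟩ := by
  induction U using Finset.induction_on generalizing P with
  | empty =>
    simp only [Finset.image_empty, Finset.biUnion_empty]
    exact .refl
  | insert Γ U hΓ ih =>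
    rw [Finset.image_insert, Finset.insert_union, Finset.biUnion_insert, Finset.image_union]
    -- The copy of `B` to be kept is available since `insert B (insert B Γ) = insert B Γ`.
    have h1 := hB (insert B Γ) (U.image (insert B) ∪ P)
    rw [Finset.insert_idem] at h1
    have e : (α.image fun C => C.image h ∪ insert B Γ)
        = (α.image fun C => C.image h ∪ Γ).image (insert B) := by
      rw [Finset.image_image]
      exact Finset.image_congr fun C _ => Finset.union_insert _ _ _
    rw [e, Finset.union_left_comm] at h1
    refine h1.trans ?_
    rw [Finset.union_comm (Finset.image _ (Finset.image _ _)) (Finset.image _ (Finset.biUnion _ _)),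
      Finset.union_assoc]
    exact ih _

theorem deduce_instances {F : Finset FunVar} {W : Finset ℕ} {B : Fml 0} {α : Mat} {X : Finset ℕ}
    (hB : ∀ (τ : ℕ → Tm 0) (Γ : Component) (ρ : Mat),
      ReflTransGen Rule ⟨F, W, insert (insert B Γ) ρ⟩
        ⟨F, W, α.image (fun C => C.image (Fml.substVars X τ) ∪ Γ) ∪ ρ⟩)
    (n : ℕ) (σ : Fin n → ℕ → Tm 0) :
    ReflTransGen Rule ⟨F, W, {{B}}⟩ ⟨F, W, (α.instances X n σ).image (insert B)⟩ := by
  induction n with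
  | zero =>
    rw [Mat.instances_zero, Finset.image_singleton, insert_empty_eq]
  | succ n ih =>
    refine (ih fun i => σ i.castSucc).trans ?_
    rw [Mat.instances_succ]
    simpa using deduce_biUnion (hB (σ (Fin.last n))) (α.instances X n fun i => σ i.castSucc) ∅

theorem deduce_delete (F : Finset FunVar) (W : Finset ℕ) (B : Fml 0) (U P : Mat) :
    ReflTransGen Rule ⟨F, W, U.image (insert B) ∪ P⟩ ⟨F, W, U ∪ P⟩ := by
  induction U using Finset.induction_on generalizing P with
  | empty =>
    rw [Finset.image_empty]
  | insert Γ U hΓ ih =>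
    have h := Del.mk F W Γ {B} (U.image (insert B) ∪ P)
    rw [Finset.union_singleton] at h
    rw [Finset.image_insert, Finset.insert_union, Finset.insert_union]
    refine .head h.rule ?_
    rw [← Finset.union_insert, ← Finset.union_insert]
    exact ih _

theorem deduce_empty_prefix (F : Finset FunVar) (W X : Finset ℕ) (hWX : Disjoint W X) :
    ReflTransGen Rule ⟨F, W ∪ X, ∅⟩ ⟨F, W, ∅⟩ := by
  induction X using Finset.induction_on with
  | empty => rw [Finset.union_empty]
  | insert x X hx ih =>
    rw [Finset.disjoint_insert_right] at hWX
    rw [Finset.union_insert]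
    have h := Inst.mk F (W ∪ X) ∅ x (by simp [hWX.1, hx]) (.var (.inl 0))
    exact .head h.rule (ih hWX.2)

/-- Every Generalized Instantiation of a matrix without empty components can be replaced by a
deduction. -/
theorem deduce_genInst (F : Finset FunVar) (W X : Finset ℕ) (hWX : Disjoint W X) (α : Mat)
    (hne : ∀ Γ ∈ α, Γ.Nonempty) (m : ℕ) (σ : Fin (m + 1) → ℕ → Tm 0) :
    ReflTransGen Rule ⟨F, W ∪ X, α⟩ ⟨F, W, α.instances X (m + 1) σ⟩ := by
  rcases α.eq_empty_or_nonempty with rfl | hα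
  · have e : Mat.instances ∅ X (m + 1) σ = ∅ := by
      rw [Mat.instances, Fintype.piFinset_empty, Finset.image_empty]
    rw [e]
    exact deduce_empty_prefix F W X hWX
  obtain ⟨A, hA⟩ := exists_disj_conj α hα hne
  have hcollect : ReflTransGen Rule ⟨F, W ∪ X, α⟩ ⟨F, W ∪ X, {{A}}⟩ := by
    have h := hA (fun a => .var (.inl a)) F (W ∪ X) ∅ ∅
    have hid : Fml.substAll (fun a => .var (.inl a)) = id := funext Fml.substAll_var
    simp only [hid, id, Finset.image_id, Finset.union_empty, Finset.image_id',
      insert_empty_eq] at h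
    exact ReflTransGen.mono (fun _ _ => GDown.rule_symm) _ _ (ReflTransGen.swap _ _ h)
  have hclose := deduce_closure F A X.toList X.nodup_toList W (by rwa [Finset.toList_toFinset])
  rw [Finset.toList_toFinset] at hclose
  refine (hcollect.trans hclose).trans ?_
  have hB : ∀ (τ : ℕ → Tm 0) (Γ : Component) (ρ : Mat),
      ReflTransGen Rule ⟨F, W, insert (insert (Fml.closure X.toList A) Γ) ρ⟩
        ⟨F, W, α.image (fun C => C.image (Fml.substVars X τ) ∪ Γ) ∪ ρ⟩ := by
    intro τ Γ ρ
    have h := deduce_closure_inst F W Γ ρ A τ X.toList fun a => .var (.inl a)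
    simp only [Fml.substAll_var, Finset.mem_toList, ← Fml.substVars_eq_substAll] at h
    exact h.trans (ReflTransGen.mono (fun _ _ => GDown.rule) _ _ (hA _ F W Γ ρ))
  refine (deduce_instances hB (m + 1) σ).trans ?_
  simpa using deduce_delete F W (Fml.closure X.toList A) (α.instances X (m + 1) σ) ∅

end QDC

/-! ### Herbrand's theorem for elementary data -/

namespace QDC

open Relation (ReflTransGen)
open FirstOrder.Language (Term)

/-- The term model, in which exactly the atomic formulas belonging to `H` are true. Its elements are
all terms, with free individual variables, so the domain is non-empty without any constant. -/
abbrev termModel (H : Set (Fml 0)) : QLang.Structure (Tm 0) where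
  funMap f ts := .func f ts
  RelMap P ts := Fml.atom P ts ∈ H

theorem termModel_realize (H : Set (Fml 0)) (v : ℕ → Tm 0) (t : Tm 0) :
    @Term.realize QLang (Tm 0) (termModel H) _ (Sum.elim v Fin.elim0) t
      = t.subst (Sum.elim v Fin.elim0) := by
  induction t with
  | var x => rcases x with a | i <;> rfl
  | func f ts ih =>
    simp only [Term.realize, Term.subst, ih]
    rfl

/-- In the term model an assignment is a substitution. So a literal is true under `v` if its
instance by `v` belongs to `H`, provided that `H` is free of contradictions. -/
theorem termModel_sat_of_mem {H : Set (Fml 0)} (hH : ∀ A ∈ H, Fml.neg A ∉ H) {v : ℕ → Tm 0}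
    {A : Fml 0} (hA : A.IsLiteral) (h : A.substAll v ∈ H) :
    A.Sat (termModel H) v Fin.elim0 := by
  cases A with
  | atom P ts =>
    simp only [Fml.Sat, termModel_realize]
    exact h
  | neg A =>
    cases A with
    | atom P ts =>
      simp only [Fml.Sat, termModel_realize]
      exact fun h' => hH _ h' h
    | _ => exact hA.elim
  | _ => exact hA.elim

/-- Compactness: if every finite family of substitutions admits a choice of components whose
instances do not contradict each other, then so does the family of all substitutions. -/
theorem exists_choice_of_instances {α : Mat} {X : Finset ℕ}
    (h : ∀ (m : ℕ) (σ : Fin (m + 1) → ℕ → Tm 0), ∃ Γ ∈ α.instances X (m + 1) σ,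
      ∀ A ∈ Γ, Fml.neg A ∉ Γ) :
    ∃ χ : (ℕ → Tm 0) → Component, (∀ σ, χ σ ∈ α) ∧ ∀ σ τ, ∀ A ∈ (χ σ).image (Fml.substVars X σ),
      Fml.neg A ∉ (χ τ).image (Fml.substVars X τ) := by
  classical
  have hfin : ∀ t : Finset (ℕ → Tm 0), ∃ g : (ℕ → Tm 0) → {Γ // Γ ∈ α}, ∀ σ ∈ t, ∀ τ ∈ t,
      ∀ A ∈ (g σ).1.image (Fml.substVars X σ),
        Fml.neg A ∉ (g τ).1.image (Fml.substVars X τ) := by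
    intro t
    -- The family `s` lists `t`; the additional value keeps it non-empty when `t` is empty.
    let s : Fin (t.card + 1) → ℕ → Tm 0 :=
      Fin.lastCases (fun a => .var (.inl a)) fun i => (t.equivFin.symm i).1
    have hs : ∀ σ, ∃ i, σ ∈ t → s i = σ := by
      intro σ
      by_cases hσ : σ ∈ t
      · exact ⟨(t.equivFin ⟨σ, hσ⟩).castSucc, fun _ => by simp [s]⟩
      · exact ⟨0, fun h => absurd h hσ⟩
    choose idx hidx using hs
    obtain ⟨Γ, hΓ, hcons⟩ := h t.card s
    obtain ⟨C, hC, rfl⟩ := Finset.mem_image.1 hΓ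
    rw [Fintype.mem_piFinset] at hC
    have hmem : ∀ σ ∈ t, ∀ A ∈ (C (idx σ)).image (Fml.substVars X σ),
        A ∈ Finset.univ.biUnion fun i => (C i).image (Fml.substVars X (s i)) := by
      intro σ hσ A hA
      exact Finset.mem_biUnion.2 ⟨idx σ, Finset.mem_univ _, by rwa [hidx σ hσ]⟩
    exact ⟨fun σ => ⟨C (idx σ), hC _⟩, fun σ hσ τ hτ A hA hA' =>
      hcons A (hmem σ hσ A hA) (hmem τ hτ _ hA')⟩
  choose g hg using hfin
  obtain ⟨χ, hχ⟩ := Finset.rado_selection (β := fun _ : ℕ → Tm 0 => {Γ // Γ ∈ α}) g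
  refine ⟨fun σ => (χ σ).1, fun σ => (χ σ).2, fun σ τ A hA hA' => ?_⟩
  -- A contradiction involves at most two substitutions.
  obtain ⟨t, ht, heq⟩ := hχ {σ, τ}
  have hσ : σ ∈ ({σ, τ} : Finset (ℕ → Tm 0)) := by simp
  have hτ : τ ∈ ({σ, τ} : Finset (ℕ → Tm 0)) := by simp
  simp only [heq σ hσ] at hA
  simp only [heq τ hτ] at hA'
  exact hg t σ (ht hσ) τ (ht hτ) A hA hA'

/-- Herbrand's theorem: otherwise the literals of a consistent choice of instances, one for each
substitution, would describe a term model that verifies the datum. -/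
theorem exists_contradictory_instances {F : Finset FunVar} {X : Finset ℕ} {α : Mat}
    (hlit : ∀ Γ ∈ α, ∀ A ∈ Γ, A.IsLiteral)
    (hunsat : ∀ (M : Type) (S : QLang.Structure M) (v : ℕ → M), ¬ Proto.Sat S v ⟨F, X, α⟩) :
    ∃ (m : ℕ) (σ : Fin (m + 1) → ℕ → Tm 0), ∀ Γ ∈ α.instances X (m + 1) σ,
      ∃ A ∈ Γ, Fml.neg A ∈ Γ := by
  by_contra! hcon
  obtain ⟨χ, hχα, hχ⟩ := exists_choice_of_instances hcon
  let H : Set (Fml 0) := {A | ∃ σ, A ∈ (χ σ).image (Fml.substVars X σ)}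
  have hH : ∀ A ∈ H, Fml.neg A ∉ H := by
    rintro A ⟨σ, hA⟩ ⟨τ, hA'⟩
    exact hχ σ τ A hA hA'
  refine hunsat (Tm 0) (termModel H) (fun a => .var (.inl a))
    ⟨termModel H, fun _ _ => rfl, fun _ _ _ => rfl, fun v hv => ⟨χ v, hχα v, fun A hA => ?_⟩⟩
  refine termModel_sat_of_mem hH (hlit _ (hχα v) A hA) ⟨v, ?_⟩
  have hv' : Fml.substVars X v = Fml.substAll v := by
    rw [Fml.substVars_eq_substAll]
    congr 1
    funext a
    split_ifs with ha
    · rfl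
    · exact (hv a ha).symm
  rw [hv']
  exact Finset.mem_image_of_mem _ hA

/-! ### Refutations -/

theorem refute_of_contradictory (F : Finset FunVar) (α : Mat)
    (h : ∀ Γ ∈ α, ∃ A ∈ Γ, Fml.neg A ∈ Γ) :
    ReflTransGen (fun p q => NC p q ∨ EVE p q) ⟨F, ∅, α⟩ ⟨∅, ∅, ∅⟩ := by
  induction α using Finset.induction_on with
  | insert Γ α hΓ ih =>
    obtain ⟨A, hA, hA'⟩ := h Γ (Finset.mem_insert_self _ _)
    have h1 := NC.mk F ∅ Γ α A
    rw [Finset.insert_eq_of_mem hA', Finset.insert_eq_of_mem hA] at h1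
    exact .head (.inl h1) (ih fun Δ hΔ => h Δ (Finset.mem_insert_of_mem hΔ))
  | empty =>
    induction F using Finset.induction_on with
    | empty => exact .refl
    | insert g F hg ih => exact .head (.inr (EVE.mk F ∅ ∅ g hg (by simp [Mat.fn]))) ih

theorem DeducibleBy.of_proto {R : Proto → Proto → Prop} {p q : Proto} (h : ReflTransGen R p q) :
    DeducibleBy R (Datum.mk p) (Datum.mk q) :=
  h.lift Datum.mk fun p q hpq => ⟨p, q, rfl, rfl, hpq⟩

theorem DeducibleBy.mono {R R' : Proto → Proto → Prop} (hR : ∀ p q, R p q → R' p q) {d e : Datum}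
    (h : DeducibleBy R d e) : DeducibleBy R' d e :=
  ReflTransGen.mono (fun _ _ ⟨p, q, hp, hq, hpq⟩ => ⟨p, q, hp, hq, hR p q hpq⟩) _ _ h

end QDC

theorem mainTheorem5 (d : QDC.Datum) (hstd : d.Standard) (hunsat : d.Unsatisfiable) :
    d.Refutable ∧
      ∃ e b : QDC.Datum,
        QDC.DeducibleBy QDC.GDown d e ∧ e.Elementary ∧
        QDC.StepBy QDC.GenInst e b ∧ QDC.Deducible e b ∧
        QDC.DeducibleBy (fun p q => QDC.NC p q ∨ QDC.EVE p q) b QDC.Datum.falsum := by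
  obtain ⟨p, rfl, -⟩ := hstd
  obtain ⟨⟨F, X, α⟩, hpe, hlit⟩ := QDC.exists_elementary p
  have hunsat' : ∀ (M : Type) (S : QDC.QLang.Structure M) (v : ℕ → M),
      ¬ QDC.Proto.Sat S v ⟨F, X, α⟩ := by
    intro M S v hsat
    refine hunsat M S v (?_ : p.Sat S v)
    clear hlit hunsat
    induction hpe using Relation.ReflTransGen.head_induction_on with
    | refl => exact hsat
    | head h _ ih => exact h.sat ih
  obtain ⟨m, σ, hcontr⟩ := QDC.exists_contradictory_instances hlit hunsat'
  -- An empty component would make the datum true in every interpretation.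
  have hne : ∀ Γ ∈ α, Γ.Nonempty := by
    intro Γ hΓ
    rw [Finset.nonempty_iff_ne_empty]
    rintro rfl
    exact hunsat' _ (QDC.termModel ∅) (fun a => .var (.inl a))
      ⟨_, fun _ _ => rfl, fun _ _ _ => rfl, fun _ _ => ⟨∅, hΓ, by simp⟩⟩
  have hde := QDC.DeducibleBy.of_proto hpe
  have hinst := QDC.GenInst.mk F ∅ X (Finset.disjoint_empty_left X) α m σ
  have heb := QDC.DeducibleBy.of_proto
    (QDC.deduce_genInst F ∅ X (Finset.disjoint_empty_left X) α hne m σ)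
  rw [Finset.empty_union] at hinst heb
  have hbot := QDC.DeducibleBy.of_proto (QDC.refute_of_contradictory F _ hcontr)
  refine ⟨?_, _, _, hde, ⟨_, rfl, hlit⟩, ⟨_, _, rfl, rfl, hinst⟩, heb, hbot⟩
  refine (hde.mono fun _ _ => QDC.GDown.rule).trans (Relation.ReflTransGen.trans heb ?_)
  exact hbot.mono fun p q h => by rcases h with h | h <;> simp [QDC.Rule, h]
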